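/- Let $n\ge 1$. Encode the vertex $(\mathbf e_i,\mathbf e_j)$ of $\Delta_{n-1}\times\Delta_{n-1}\subset\mathbb R^n\times\mathbb R^n$ by the square $(i,\overline j)$ of the $n\times n$ grid, equivalently by the edge $(i,\overline j)$ of the complete bipartite graph $K_{n,n}$ ($1\le i,j\le n$). A Dyck path is a set of squares $\{(i_k,\overline{j_k}) : 1\le k\le 2n-1\}$ with $(i_1,j_1)=(1,1)$, $(i_{2n-1},j_{2n-1})=(n,n)$, each $(i_{k+1},j_{k+1})$ equal to $(i_k+1,j_k)$ or $(i_k,j_k+1)$, and $i_k\le j_k$ for all $k$. Let $\mathcal D_n$ be the collection of all sets of squares obtained from Dyck paths by adding some $\ell\in\{1,\dots,n\}$ to both indices of every square, modulo $n$. Then: 1. $\mathcal D_n$ is the set of maximal simplices of a triangulation of $\Delta_{n-1}\times\Delta_{n-1}$ that uses only vertices of $\Delta_{n-1}\times\Delta_{n-1}$ (the *Dyck path triangulation*). 2. A matching is a nonempty set of pairwise disjoint edges of $K_{n,n}$; its support $(I,\overline J)$ consists of the vertices that it covers. Let $\mathcal M_n$ be the set of all matchings $\{(i+\ell,\ \overline{j+\ell})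 \pmod n : (i,\overline j)\in M\}$, where $\ell\in\{1,\dots,n\}$ and $M$ is a matching that is non-crossing ($i<i'\Rightarrow j<j'$ for all $(i,\overline j),(i',\overline{j'})\in M$) and weakly increasing ($i\le j$ for all $(i,\overline j)\in M$). Then the matchings contained in the simplices of $\mathcal D_n$ are exactly the members of $\mathcal M_n$, and $\mathcal M_n$ is a matching ensemble, that is: (SA) for all nonempty $I\subseteq[n]$, $\overline J\subseteq[\overline n]$ with $|I|=|\overline J|$ there is exactly one $M\in\mathcal M_n$ with support $(I,\overline J)$; (CA) every nonempty subset of a member of $\mathcal M_n$ is in $\mathcal M_n$; (LA) for every $M\in\mathcal M_n$ and every vertex $v$ of $K_{n,n}$ not covered by $M$ there are $e\in M$ and an edge $e'$ of $K_{n,n}$ such that $v\in e'$, $e$ and $e'$ share a vertex, and $(M\setminus\{e\})\cup\{e'\}\in\mathcal M_n$. 3. Let $r(i,\overline j)\in\{0,\dots,n-1\}$ be the residue of $j-i$ modulo $n$. For every linear order of the $n^2$ squares in which $q$ precedes $q'$ whenever $r(q)<r(q')$, the Dyck path triangulation is the pushing (placing) triangulation of the vertices of $\Delta_{n-1}\times\Delta_{n-1}$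 in this order. Here one starts with the empty simplex only and inserts the points one by one in the given order; if $P$ is the convex hull of the points already inserted and $p\notin P$ is the next point, then $p$ is joined to every simplex $B$ of the current triangulation that is visible from $p$, meaning that $[p,x]\cap P=\{x\}$ for all $x\in\operatorname{conv}B$ (if $p\in P$, nothing is added). 4. The Dyck path triangulation is regular: there is a real number $c_0$ such that for every real $c>c_0$, $\mathcal D_n$ is the set of maximal cells of the regular subdivision of the vertices of $\Delta_{n-1}\times\Delta_{n-1}$ induced by the heights $h(\mathbf e_i,\mathbf e_j)=c^{\,r(i,\overline j)}$, where the cells are the sets of vertices on which some affine function $\varphi$ with $\varphi\le h$ at all vertices attains equality. -/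

import Mathlib

namespace DyckTriangulation

/-! Squares of the grid (equivalently: vertices of the product of two simplices, or edges of the
complete bipartite graph) are the pairs `(i, j) : Fin m × Fin n`; indices start at `0`. -/

/-- The vertex `(e_i, e_j)` of the product of two standard simplices. -/
def vertex (m n : ℕ) (q : Fin m × Fin n) : (Fin m → ℝ) × (Fin n → ℝ) :=
  (Pi.single q.1 1, Pi.single q.2 1)

/-- The product of the standard simplices with `m` and with `n` vertices. -/
def simplexProduct (m n : ℕ) : Set ((Fin m → ℝ) × (Fin n → ℝ)) :=
  stdSimplex ℝ (Fin m) ×ˢ stdSimplex ℝ (Fin n)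

open Classical in
/-- `T` is the set of maximal simplices (given by their sets of vertices) of a triangulation of the
product of two simplices: there is a geometric simplicial complex that uses only vertices of the
product, that covers exactly the product, and whose facets are exactly the members of `T`. -/
def IsTriangulation {m n : ℕ} (T : Set (Finset (Fin m × Fin n))) : Prop :=
  ∃ K : Geometry.SimplicialComplex ℝ ((Fin m → ℝ) × (Fin n → ℝ)),
    K.vertices ⊆ Set.range (vertex m n) ∧
    K.space = simplexProduct m n ∧
    K.facets = (fun s : Finset (Fin m × Fin n) => s.image (vertex m n)) '' T

/-! ### Dyck paths and their orbit -/

/-- A single step of a monotone lattice path: one square to the right or one square up. -/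
def IsStep {n : ℕ} (a b : Fin n × Fin n) : Prop :=
  ((b.1 : ℕ) = a.1 + 1 ∧ b.2 = a.2) ∨ (b.1 = a.1 ∧ (b.2 : ℕ) = a.2 + 1)

/-- `s` is the set of squares of a Dyck path in the `n × n` grid: a monotone path
`p 0, …, p (2n-2)` from the first to the last square that stays weakly above the diagonal. -/
def IsDyckPath {n : ℕ} (s : Finset (Fin n × Fin n)) : Prop :=
  ∃ p : ℕ → Fin n × Fin n,
    (((p 0).1 : ℕ) = 0 ∧ ((p 0).2 : ℕ) = 0) ∧
    (((p (2 * n - 2)).1 : ℕ) + 1 = n ∧ ((p (2 * n - 2)).2 : ℕ) + 1 = n) ∧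
    (∀ k < 2 * n - 2, IsStep (p k) (p (k + 1))) ∧
    (∀ k ≤ 2 * n - 2, (p k).1 ≤ (p k).2) ∧
    s = (Finset.range (2 * n - 1)).image p

/-- The simultaneous cyclic shift of both indices by `l`; addition in `Fin n` is modulo `n`. -/
def shift {n : ℕ} (l : Fin n) (s : Finset (Fin n × Fin n)) : Finset (Fin n × Fin n) :=
  s.image fun q => (q.1 + l, q.2 + l)

/-- The maximal simplices of the Dyck path triangulation: all cyclic shifts of Dyck paths. -/
def dyckSimplices (n : ℕ) : Set (Finset (Fin n × Fin n)) :=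
  {t | ∃ (l : Fin n) (s : Finset (Fin n × Fin n)), IsDyckPath s ∧ t = shift l s}

/-! ### Matchings and matching ensembles -/

/-- `M` is a set of pairwise disjoint edges, i.e. a perfect matching of the subgraph induced by
`M.image Prod.fst` and `M.image Prod.snd`. -/
def IsMatching {m n : ℕ} (M : Finset (Fin m × Fin n)) : Prop :=
  Set.InjOn Prod.fst (M : Set (Fin m × Fin n)) ∧ Set.InjOn Prod.snd (M : Set (Fin m × Fin n))

/-- Matching ensembles: families of (nonempty) matchings that satisfy the supports axiom, the
closure axiom and the linkage axiom (for a new vertex on the left and on the right). -/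
structure IsMatchingEnsemble {m n : ℕ} (F : Set (Finset (Fin m × Fin n))) : Prop where
  matching : ∀ M ∈ F, M.Nonempty ∧ IsMatching M
  supports : ∀ (I : Finset (Fin m)) (J : Finset (Fin n)), I.Nonempty → I.card = J.card →
    ∃! M, M ∈ F ∧ M.image Prod.fst = I ∧ M.image Prod.snd = J
  closed : ∀ M ∈ F, ∀ M' ⊆ M, M'.Nonempty → M' ∈ F
  linkage_left : ∀ M ∈ F, ∀ v : Fin m, v ∉ M.image Prod.fst →
    ∃ e ∈ M, ∃ e' : Fin m × Fin n, (e'.1 = e.1 ∨ e'.2 = e.2) ∧ e'.1 = v ∧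
      insert e' (M.erase e) ∈ F
  linkage_right : ∀ M ∈ F, ∀ v : Fin n, v ∉ M.image Prod.snd →
    ∃ e ∈ M, ∃ e' : Fin m × Fin n, (e'.1 = e.1 ∨ e'.2 = e.2) ∧ e'.2 = v ∧
      insert e' (M.erase e) ∈ F

/-- The family of matchings of a triangulation with maximal simplices `T`: the nonempty matchings
that are contained in a simplex. -/
def matchingsOf {m n : ℕ} (T : Set (Finset (Fin m × Fin n))) : Set (Finset (Fin m × Fin n)) :=
  {M | M.Nonempty ∧ IsMatching M ∧ ∃ s ∈ T, M ⊆ s}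

/-- Non-crossing and weakly increasing matchings. -/
def IsNCWI {n : ℕ} (M : Finset (Fin n × Fin n)) : Prop :=
  IsMatching M ∧ (∀ e ∈ M, ∀ e' ∈ M, e.1 < e'.1 → e.2 < e'.2) ∧ ∀ e ∈ M, e.1 ≤ e.2

/-- The cyclic shifts of the (nonempty) non-crossing, weakly increasing matchings. -/
def dyckMatchings (n : ℕ) : Set (Finset (Fin n × Fin n)) :=
  {N | ∃ (l : Fin n) (M : Finset (Fin n × Fin n)), M.Nonempty ∧ IsNCWI M ∧ N = shift l M}

/-! ### Regular subdivisions -/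

section Configuration

variable {ι E : Type*} [AddCommGroup E] [Module ℝ E]

/-- `B` is a cell of the regular subdivision of the point configuration `A` induced by the heights
`h`: some affine function lies weakly below all lifted points and touches exactly those in `B`. -/
def IsLowerCell (A : ι → E) (h : ι → ℝ) (B : Finset ι) : Prop :=
  ∃ φ : E →ᵃ[ℝ] ℝ, (∀ k, φ (A k) ≤ h k) ∧ ∀ k, k ∈ B ↔ φ (A k) = h k

/-- The maximal cells of the regular subdivision of `A` induced by the heights `h`. -/
def regularSubdivision (A : ι → E) (h : ι → ℝ) : Set (Finset ι) :=
  {B | Maximal (IsLowerCell A h) B}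

/-! ### Pushing (placing) triangulations -/

/-- The subset `F` of the convex set `P` is visible from the point `p` outside `P`. -/
def IsVisible (P : Set E) (p : E) (F : Set E) : Prop :=
  p ∉ P ∧ ∀ x ∈ F, segment ℝ p x ∩ P = {x}

open Classical in
/-- All simplices (including the empty one) of the triangulation obtained by inserting the points
of the list one at a time, the *last* entry first: a new point is joined to all the simplices of
the current triangulation that are visible from it. -/
def placeFromEnd (A : ι → E) : List ι → Set (Finset ι)
  | [] => {∅}
  | a :: l => placeFromEnd A l ∪
      {C | ∃ B ∈ placeFromEnd A l,
        IsVisible (convexHull ℝ (A '' {k | k ∈ l})) (A a) (convexHull ℝ (A '' (B : Set ι))) ∧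
        C = insert a B}

/-- All simplices (including the empty one) of the pushing triangulation of `A` with respect to
the order in which the list enumerates the points. -/
def pushingTriangulation (A : ι → E) (l : List ι) : Set (Finset ι) :=
  placeFromEnd A l.reverse

end Configuration

/-- The residue of `j - i` modulo `n` in `{0, …, n-1}`; subtraction in `Fin n` is modulo `n`. -/
def residue {n : ℕ} (q : Fin n × Fin n) : ℕ := ((q.2 - q.1 : Fin n) : ℕ)

/-- The list `l` enumerates all squares, each one once, in a linear order that extends the partial
order in which `q` precedes `q'` when the residue of `q` is smaller than that of `q'`. -/
def IsResidueOrder {n : ℕ} (l : List (Fin n × Fin n)) : Prop :=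
  l.Nodup ∧ (∀ q, q ∈ l) ∧ l.Pairwise fun q q' => residue q ≤ residue q'

end DyckTriangulation

namespace DyckTriangulation

/-! ### Dyck paths and staircases -/

/-! Two facts about weights on squares carry everything.

Existence (`exists_coupling`): nonnegative vectors `x`, `y` with equal totals are the marginals of
nonnegative weights supported on a single Dyck path simplex. The cycle lemma gives a rotation after
which every partial sum of `x` is at least that of `y`. Cutting an interval into pieces of lengths
`x i` and, separately, `y j`, and weighting `(i, j)` by the overlap of the two pieces, fills only a
chain of squares weakly above the diagonal; `exists_path_through_chain` extends it to a Dyck path.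

Uniqueness (`eq_of_sum_smul_vertex_eq`): nonnegative weights on Dyck path simplices are determined
by their marginals. The test functional of `exists_separating` is `1` at a square `q` of the simplex
`s`, nonpositive at all other squares of no larger residue, and `0` at those of them in `s`. Hence
on the top residue, weights on `s` are dominated by every nonnegative competitor. Two such
weightings agree there by symmetry, and one peels off residues one at a time.

Existence gives covering; uniqueness gives affine independence and proper intersections. For
matchings, Hall's theorem extracts a matching from a coupling with constant marginals on `I` and
`J`, and uniqueness identifies it. Marginals `|I|` on `I ∪ {v}` and `|I| + 1` on `J` place the
matching and an edge at `v` in one simplex, which is linkage. Domination on the top residue decides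
visibility in the pushing construction. For regularity, test functionals are added residue by
residue to give a supporting function for each simplex, and transporting the indicator of a cell to
a Dyck path simplex shows that no other maximal cells exist. -/

lemma exists_path_through_chain {n : ℕ} (hn : 1 ≤ n) (C : Finset (Fin n × Fin n))
    (hle : ∀ q ∈ C, q.1 ≤ q.2) (hchain : ∀ q ∈ C, ∀ q' ∈ C, q.1 < q'.1 → q.2 ≤ q'.2) :
    ∃ s, IsDyckPath s ∧ C ⊆ s := by
  classical
  -- Greedy rule: raise the second coordinate only on the diagonal or when a square of `C` would
  -- otherwise be missed.
  let up : ℕ × ℕ → Prop := fun a =>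
    a.1 = a.2 ∨ ∃ q ∈ C, (q.1 : ℕ) ≤ a.1 ∧ a.2 < (q.2 : ℕ)
  let p : ℕ → ℕ × ℕ := fun k =>
    Nat.rec (0, 0) (fun _ a => if up a then (a.1, a.2 + 1) else (a.1 + 1, a.2)) k
  have hp0 : p 0 = (0, 0) := rfl
  have hpS : ∀ k, p (k + 1) =
      if up (p k) then ((p k).1, (p k).2 + 1) else ((p k).1 + 1, (p k).2) := fun _ => rfl
  have hsum : ∀ k, (p k).1 + (p k).2 = k := by
    intro k
    induction k with
    | zero => rfl
    | succ k ih => rw [hpS]; split_ifs <;> simp only <;> omega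
  -- The last two clauses say that every square of `C` is comparable with `p k` in the product
  -- order. Comparable squares with equal coordinate sums coincide, so the path meets `q ∈ C` at
  -- time `q.1 + q.2`.
  have hinv : ∀ k ≤ 2 * n - 2, (p k).1 ≤ (p k).2 ∧ (p k).2 + 1 ≤ n ∧
      (∀ q ∈ C, (q.1 : ℕ) < (p k).1 → (q.2 : ℕ) ≤ (p k).2) ∧
      (∀ q ∈ C, (q.2 : ℕ) < (p k).2 → (q.1 : ℕ) ≤ (p k).1) := by
    intro k
    induction k with
    | zero => intro _; rw [hp0]; simp [hn]
    | succ k ih =>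
      intro hk
      obtain ⟨h1, h2, h3, h4⟩ := ih (by omega)
      have hs := hsum k
      rw [hpS]
      split_ifs with h
      · refine ⟨by simp only; omega, ?_, fun q hq hlt => (h3 q hq hlt).trans (Nat.le_succ _),
          fun q hq hlt => ?_⟩
        · rcases h with h | ⟨q, hq, h5, h6⟩
          · simp only; omega
          · have := q.2.isLt
            simp only; omega
        · simp only at hlt ⊢
          rcases h with h | ⟨q', hq', h5, h6⟩
          · have : (q.1 : ℕ) ≤ q.2 := hle q hq
            omega
          · by_contra hcon
            have : (q'.2 : ℕ) ≤ q.2 := hchain q' hq' q hq (Fin.lt_def.2 (by omega))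
            omega
      · have hne : (p k).1 ≠ (p k).2 := fun h' => h (Or.inl h')
        refine ⟨by simp only; omega, h2, fun q hq hlt => ?_,
          fun q hq hlt => (h4 q hq hlt).trans (Nat.le_succ _)⟩
        simp only at hlt ⊢
        by_contra hcon
        exact h (Or.inr ⟨q, hq, by omega, by omega⟩)
  -- The reduction modulo `n` only makes the path total; it changes nothing for `k ≤ 2 * n - 2`.
  let P : ℕ → Fin n × Fin n := fun k =>
    (⟨(p k).1 % n, Nat.mod_lt _ hn⟩, ⟨(p k).2 % n, Nat.mod_lt _ hn⟩)
  have hP1 : ∀ k ≤ 2 * n - 2, ((P k).1 : ℕ) = (p k).1 := fun k hk =>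
    Nat.mod_eq_of_lt (by have := hinv k hk; omega)
  have hP2 : ∀ k ≤ 2 * n - 2, ((P k).2 : ℕ) = (p k).2 := fun k hk =>
    Nat.mod_eq_of_lt (by have := hinv k hk; omega)
  refine ⟨(Finset.range (2 * n - 1)).image P, ⟨P, ?_, ?_, ?_, ?_, rfl⟩, ?_⟩
  · rw [hP1 0 (by omega), hP2 0 (by omega), hp0]; simp
  · rw [hP1 _ le_rfl, hP2 _ le_rfl]
    have := hinv _ le_rfl
    have := hsum (2 * n - 2)
    omega
  · intro k hk
    have e1 := hP1 k hk.le
    have e2 := hP2 k hk.le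
    have e3 := hP1 (k + 1) hk
    have e4 := hP2 (k + 1) hk
    rw [hpS] at e3 e4
    unfold IsStep
    rw [Fin.ext_iff, Fin.ext_iff]
    split_ifs at e3 e4 <;> simp only at e3 e4 <;> omega
  · intro k hk
    rw [Fin.le_def, hP1 k hk, hP2 k hk]
    exact (hinv k hk).1
  · intro q hq
    have hq1 := q.1.isLt
    have hq2 := q.2.isLt
    have hk : (q.1 : ℕ) + q.2 ≤ 2 * n - 2 := by omega
    obtain ⟨-, -, h3, h4⟩ := hinv _ hk
    have hs := hsum (q.1 + q.2)
    have h3 := h3 q hq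
    have h4 := h4 q hq
    refine Finset.mem_image.2 ⟨q.1 + q.2, Finset.mem_range.2 (by omega), ?_⟩
    rw [Prod.ext_iff, Fin.ext_iff, Fin.ext_iff, hP1 _ hk, hP2 _ hk]
    omega

/-! ### Order and cardinality of Dyck paths -/

section Path

variable {n : ℕ} {s : Finset (Fin n × Fin n)}

lemma IsDyckPath.fst_le_snd (hs : IsDyckPath s) {q : Fin n × Fin n} (hq : q ∈ s) :
    q.1 ≤ q.2 := by
  obtain ⟨p, -, -, -, hle, rfl⟩ := hs
  obtain ⟨k, hk, rfl⟩ := Finset.mem_image.1 hq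
  exact hle k (by have := Finset.mem_range.1 hk; omega)

lemma IsDyckPath.chain (hs : IsDyckPath s) {q q' : Fin n × Fin n} (hq : q ∈ s) (hq' : q' ∈ s)
    (h : q.1 < q'.1) : q.2 ≤ q'.2 := by
  obtain ⟨p, -, -, hstep, -, rfl⟩ := hs
  obtain ⟨k, hk, rfl⟩ := Finset.mem_image.1 hq
  obtain ⟨k', hk', rfl⟩ := Finset.mem_image.1 hq'
  have hk := Finset.mem_range.1 hk
  have hk' := Finset.mem_range.1 hk'
  have mono : ∀ a b, a ≤ b → b ≤ 2 * n - 2 → (p a).1 ≤ (p b).1 ∧ (p a).2 ≤ (p b).2 := by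
    intro a b hab
    induction b, hab using Nat.le_induction with
    | base => intro _; exact ⟨le_rfl, le_rfl⟩
    | succ b hab ih =>
      intro hb
      obtain ⟨h1, h2⟩ := ih (by omega)
      rw [Fin.le_def] at *
      rcases hstep b (by omega) with ⟨h3, h4⟩ | ⟨h3, h4⟩
      · rw [h4]; exact ⟨by omega, h2⟩
      · rw [h3]; exact ⟨h1, by rw [Fin.le_def] at *; omega⟩
  rcases le_total k k' with hkk | hkk
  · exact (mono k k' hkk (by omega)).2
  · exact absurd (mono k' k hkk (by omega)).1 (not_le.2 h)

/-- The coordinate sum grows by one per step, so the squares are distinct. The common cardinality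
later prevents one simplex from properly containing another. -/
lemma IsDyckPath.card (hs : IsDyckPath s) : s.card = 2 * n - 1 := by
  obtain ⟨p, h0, -, hstep, -, rfl⟩ := hs
  have hsum : ∀ k ≤ 2 * n - 2, ((p k).1 : ℕ) + (p k).2 = k := by
    intro k
    induction k with
    | zero => intro _; omega
    | succ k ih =>
      intro hk
      have ih := ih (by omega)
      rcases hstep k (by omega) with ⟨h3, h4⟩ | ⟨h3, h4⟩
      · rw [h4]; omega
      · rw [h3]; omega
  rw [Finset.card_image_of_injOn, Finset.card_range]
  intro a ha b hb hab
  have ha := Finset.mem_range.1 ha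
  have hb := Finset.mem_range.1 hb
  have hab : p a = p b := hab
  rw [← hsum a (by omega), ← hsum b (by omega), hab]

end Path

/-! ### Cyclic shifts and the matchings in the simplices -/

section Shift

variable {n : ℕ}

lemma shift_injective (l : Fin n) :
    Function.Injective fun q : Fin n × Fin n => (q.1 + l, q.2 + l) := by
  intro a b h
  simp only [Prod.mk.injEq, add_left_inj] at h
  exact Prod.ext h.1 h.2

/-- The linear functional `∑ i ∈ I, x i - ∑ j ∈ J, y j`. -/
noncomputable def cut (I J : Finset (Fin n)) : ((Fin n → ℝ) × (Fin n → ℝ)) →ₗ[ℝ] ℝ :=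
  (∑ i ∈ I, LinearMap.proj i) ∘ₗ LinearMap.fst ℝ _ _ -
    (∑ j ∈ J, LinearMap.proj j) ∘ₗ LinearMap.snd ℝ _ _

lemma cut_vertex (I J : Finset (Fin n)) (q : Fin n × Fin n) :
    cut I J (vertex n n q) = (if q.1 ∈ I then 1 else 0) - if q.2 ∈ J then 1 else 0 := by
  simp [cut, vertex, Pi.single_apply]

lemma card_of_mem_dyckSimplices {s : Finset (Fin n × Fin n)} (hs : s ∈ dyckSimplices n) :
    s.card = 2 * n - 1 := by
  obtain ⟨l, s, hs, rfl⟩ := hs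
  rw [shift, Finset.card_image_of_injective _ (shift_injective l), hs.card]

lemma eq_of_subset_of_mem_dyckSimplices {s t : Finset (Fin n × Fin n)}
    (hs : s ∈ dyckSimplices n) (ht : t ∈ dyckSimplices n) (h : s ⊆ t) : s = t :=
  Finset.eq_of_subset_of_card_le h
    (by rw [card_of_mem_dyckSimplices hs, card_of_mem_dyckSimplices ht])

variable [NeZero n]

lemma mem_shift {l : Fin n} {s : Finset (Fin n × Fin n)} {q : Fin n × Fin n} :
    q ∈ shift l s ↔ (q.1 - l, q.2 - l) ∈ s := by
  unfold shift
  rw [Finset.mem_image]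
  constructor
  · rintro ⟨a, ha, rfl⟩; simpa using ha
  · intro h; exact ⟨_, h, by simp⟩

lemma exists_dyckSimplex_of_chain (l : Fin n) (C : Finset (Fin n × Fin n))
    (hle : ∀ q ∈ C, q.1 - l ≤ q.2 - l)
    (hchain : ∀ q ∈ C, ∀ q' ∈ C, q.1 - l < q'.1 - l → q.2 - l ≤ q'.2 - l) :
    ∃ s ∈ dyckSimplices n, C ⊆ s := by
  obtain ⟨s, hs, hC⟩ := exists_path_through_chain (Nat.one_le_iff_ne_zero.2 (NeZero.ne n))
    (C.image fun q => (q.1 - l, q.2 - l))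
    (by simp only [Finset.forall_mem_image]; exact hle)
    (by simp only [Finset.forall_mem_image]; exact hchain)
  exact ⟨shift l s, ⟨l, s, hs, rfl⟩, fun q hq => mem_shift.2 (hC (Finset.mem_image_of_mem _ hq))⟩

lemma exists_dyckSimplex_mem (q : Fin n × Fin n) : ∃ s ∈ dyckSimplices n, q ∈ s := by
  obtain ⟨s, hs, h⟩ := exists_dyckSimplex_of_chain q.1 {q} (by simp)
    (by simp)
  exact ⟨s, hs, h (Finset.mem_singleton_self q)⟩

lemma residue_eq_of_le (l : Fin n) {q : Fin n × Fin n} (h : q.1 - l ≤ q.2 - l) :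
    residue q = ((q.2 - l : Fin n) : ℕ) - ((q.1 - l : Fin n) : ℕ) := by
  rw [residue, ← sub_sub_sub_cancel_right q.2 q.1 l, Fin.sub_val_of_le h]

/-- A path is only weakly monotone; disjointness of the edges makes the inequality strict, which is
the non-crossing condition. Conversely, a non-crossing weakly increasing matching is a chain and
extends to a path. -/
lemma matchingsOf_dyckSimplices : matchingsOf (dyckSimplices n) = dyckMatchings n := by
  ext M
  constructor
  · rintro ⟨hne, hM, _, ⟨l, s, hs, rfl⟩, hMs⟩
    refine ⟨l, M.image fun q => (q.1 - l, q.2 - l), hne.image _, ⟨⟨?_, ?_⟩, ?_, ?_⟩, ?_⟩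
    · rw [Finset.coe_image]
      rintro _ ⟨a, ha, rfl⟩ _ ⟨b, hb, rfl⟩ hab
      rw [hM.1 ha hb (sub_left_injective hab)]
    · rw [Finset.coe_image]
      rintro _ ⟨a, ha, rfl⟩ _ ⟨b, hb, rfl⟩ hab
      rw [hM.2 ha hb (sub_left_injective hab)]
    · simp only [Finset.forall_mem_image]
      intro a ha b hb hab
      refine lt_of_le_of_ne (hs.chain (mem_shift.1 (hMs ha)) (mem_shift.1 (hMs hb)) hab) ?_
      intro h
      rw [hM.2 ha hb (sub_left_injective h)] at hab
      exact lt_irrefl _ hab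
    · simp only [Finset.forall_mem_image]
      exact fun a ha => hs.fst_le_snd (mem_shift.1 (hMs ha))
    · rw [shift, Finset.image_image]
      simp [Function.comp_def]
  · rintro ⟨l, M, hne, ⟨hM, hnc, hle⟩, rfl⟩
    obtain ⟨s, hs, hMs⟩ := exists_path_through_chain (Nat.one_le_iff_ne_zero.2 (NeZero.ne n)) M hle
      fun q hq q' hq' h => (hnc q hq q' hq' h).le
    refine ⟨hne.image _, ⟨?_, ?_⟩, shift l s, ⟨l, s, hs, rfl⟩, Finset.image_subset_image hMs⟩
    · rw [shift, Finset.coe_image]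
      rintro _ ⟨a, ha, rfl⟩ _ ⟨b, hb, rfl⟩ hab
      rw [hM.1 ha hb (add_left_injective l hab)]
    · rw [shift, Finset.coe_image]
      rintro _ ⟨a, ha, rfl⟩ _ ⟨b, hb, rfl⟩ hab
      rw [hM.2 ha hb (add_left_injective l hab)]

/-! ### Separating functionals -/

/-- For a square `q` of a Dyck path simplex `s` there is a linear functional that separates `q`
from all the other squares of at most the same residue, and vanishes on those of them in `s`. -/
lemma exists_separating {s : Finset (Fin n × Fin n)} (hs : s ∈ dyckSimplices n)
    {q : Fin n × Fin n} (hq : q ∈ s) :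
    ∃ f : ((Fin n → ℝ) × (Fin n → ℝ)) →ₗ[ℝ] ℝ, f (vertex n n q) = 1 ∧
      (∀ p, p ≠ q → residue p ≤ residue q → f (vertex n n p) ≤ 0) ∧
      (∀ p ∈ s, p ≠ q → residue p ≤ residue q → f (vertex n n p) = 0) ∧
      ∀ p, |f (vertex n n p)| ≤ 1 := by
  obtain ⟨l, s, hs, rfl⟩ := hs
  have hq := mem_shift.1 hq
  have hqle := hs.fst_le_snd hq
  -- In shifted coordinates the residue is the length of the interval from first to second index. An
  -- interval containing that of `q` is strictly longer unless `p = q`.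
  have hnp : ∀ p : Fin n × Fin n, p ≠ q → residue p ≤ residue q →
      p.1 - l ≤ q.1 - l → p.2 - l < q.2 - l := by
    intro p hne hr h1
    by_contra h2
    rw [not_lt] at h2
    rw [residue_eq_of_le l (h1.trans (hqle.trans h2)), residue_eq_of_le l hqle] at hr
    apply hne
    rw [Fin.le_def] at h1 h2 hqle
    have e1 : p.1 - l = q.1 - l := Fin.ext (by simp only at hqle; omega)
    have e2 : p.2 - l = q.2 - l := Fin.ext (by simp only at hqle; omega)
    exact Prod.ext (sub_left_injective e1) (sub_left_injective e2)
  -- The value is `1` exactly when the interval of `p` contains that of `q`. It is `-1` exactly when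
  -- `p.1` exceeds `q.1` and `p.2` is below `q.2` (shifted), which the chain property forbids inside
  -- `s`.
  refine ⟨cut {k | k - l ≤ q.1 - l} {k | k - l < q.2 - l}, ?_, ?_, ?_, ?_⟩
  · simp [cut_vertex]
  · intro p hne hr
    have := hnp p hne hr
    simp only [cut_vertex, Finset.mem_filter, Finset.mem_univ, true_and]
    split_ifs <;> simp_all
  · intro p hp hne hr
    have h1 := hnp p hne hr
    have h2 : p.2 - l < q.2 - l → p.1 - l ≤ q.1 - l := by
      intro h
      by_contra h'
      exact absurd (hs.chain hq (mem_shift.1 hp) (not_le.1 h')) (not_le.2 h)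
    simp only [cut_vertex, Finset.mem_filter, Finset.mem_univ, true_and]
    split_ifs <;> simp_all
  · intro p
    simp only [cut_vertex]
    split_ifs <;> simp

end Shift

/-! ### Couplings supported on Dyck path simplices -/

section Coupling

variable {n : ℕ}

lemma sum_smul_vertex (w : Fin n × Fin n → ℝ) :
    ∑ q, w q • vertex n n q = (fun i => ∑ j, w (i, j), fun j => ∑ i, w (i, j)) := by
  rw [Fintype.sum_prod_type]
  ext k
  · simp [vertex, Prod.fst_sum, Finset.sum_apply, Pi.single_apply]
  · rw [Finset.sum_comm]
    simp [vertex, Prod.snd_sum, Finset.sum_apply, Pi.single_apply]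

lemma map_sum_smul_vertex (f : ((Fin n → ℝ) × (Fin n → ℝ)) →ₗ[ℝ] ℝ) (w : Fin n × Fin n → ℝ) :
    f (∑ q, w q • vertex n n q) = ∑ q, w q * f (vertex n n q) := by
  simp [map_sum]

/-- Supermodularity of `min`, which makes the overlap weights below nonnegative. -/
lemma min_add_min_le {a a' b b' : ℝ} (ha : a ≤ a') (hb : b ≤ b') :
    min a' b + min a b' ≤ min a' b' + min a b := by
  rcases le_total a b with h | h <;> rcases le_total a' b' with h' | h' <;>
    rcases le_total a b' with h1 | h1 <;> rcases le_total a' b with h2 | h2 <;>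
    simp only [min_eq_left, min_eq_right, h, h', h1, h2] <;> linarith

/-- The cycle lemma. -/
lemma exists_cyclic_shift_nonneg [NeZero n] (z : Fin n → ℝ) (hz : ∑ i, z i = 0) :
    ∃ l : ℕ, ∀ k, 0 ≤ ∑ i ∈ Finset.range k, z (Fin.ofNat n (l + i)) := by
  set Z : ℕ → ℝ := fun k => ∑ i ∈ Finset.range k, z (Fin.ofNat n i) with hZ
  have hper : Function.Periodic Z n := by
    intro k
    simp only [hZ]
    rw [add_comm, Finset.sum_range_add, ← Fin.sum_univ_eq_sum_range (fun i => z (Fin.ofNat n i))]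
    have : ∑ i : Fin n, z (Fin.ofNat n i) = 0 := by rw [← hz]; simp
    rw [this, zero_add]
    refine Finset.sum_congr rfl fun i _ => congrArg z (Fin.ext ?_)
    simp
  -- The partial sums are periodic because the total is zero; the rotation starts where they are
  -- smallest.
  obtain ⟨l, -, hl⟩ := Finset.exists_min_image (Finset.range n) Z
    ⟨0, Finset.mem_range.2 (Nat.pos_of_ne_zero (NeZero.ne n))⟩
  refine ⟨l, fun k => ?_⟩
  have h := hl ((l + k) % n)
    (Finset.mem_range.2 (Nat.mod_lt _ (Nat.pos_of_ne_zero (NeZero.ne n))))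
  rw [hper.map_mod_nat] at h
  simp only [hZ, Finset.sum_range_add] at h
  linarith

/-- Any two vectors of nonnegative numbers with the same sum are the marginals of a coupling that
is supported on a simplex of the Dyck path triangulation. -/
lemma exists_coupling [NeZero n] (x y : Fin n → ℝ) (hx : ∀ i, 0 ≤ x i) (hy : ∀ i, 0 ≤ y i)
    (hxy : ∑ i, x i = ∑ i, y i) :
    ∃ s ∈ dyckSimplices n, ∃ w : Fin n × Fin n → ℝ, (∀ q, 0 ≤ w q) ∧ (∀ q ∉ s, w q = 0) ∧
      (∀ i, ∑ j, w (i, j) = x i) ∧ ∀ j, ∑ i, w (i, j) = y j := by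
  obtain ⟨m, hm⟩ := exists_cyclic_shift_nonneg (fun i => x i - y i) (by simp [hxy])
  set l : Fin n := Fin.ofNat n m with hl
  let X : ℕ → ℝ := fun k => ∑ i ∈ Finset.range k, x (Fin.ofNat n (m + i))
  let Y : ℕ → ℝ := fun k => ∑ i ∈ Finset.range k, y (Fin.ofNat n (m + i))
  have hXY : ∀ k, Y k ≤ X k := fun k => by
    have := hm k
    rw [Finset.sum_sub_distrib] at this
    exact sub_nonneg.1 this
  have hcast : ∀ i : Fin n, Fin.ofNat n (m + ((i - l : Fin n) : ℕ)) = i := by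
    intro i
    have : Fin.ofNat n (m + ((i - l : Fin n) : ℕ)) = l + (i - l) := by
      apply Fin.ext
      rw [Fin.val_add]
      exact (Nat.mod_add_mod m n _).symm
    rw [this, add_sub_cancel]
  have htot : ∀ u : Fin n → ℝ,
      ∑ i ∈ Finset.range n, u (Fin.ofNat n (m + i)) = ∑ i, u i := by
    intro u
    rw [← Fin.sum_univ_eq_sum_range (fun i => u (Fin.ofNat n (m + i))),
      ← Equiv.sum_comp (Equiv.subRight l)]
    exact Finset.sum_congr rfl fun i _ => congrArg u (hcast i)
  have hXn : X n = Y n := by simp only [X, Y, htot, hxy]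
  have hXm : Monotone X := monotone_nat_of_le_succ fun k => by
    simp only [X, Finset.sum_range_succ]; linarith [hx (Fin.ofNat n (m + k))]
  have hYm : Monotone Y := monotone_nat_of_le_succ fun k => by
    simp only [Y, Finset.sum_range_succ]; linarith [hy (Fin.ofNat n (m + k))]
  have hX0 : X 0 = 0 := rfl
  have hY0 : Y 0 = 0 := rfl
  -- The overlap length of `[X i, X (i + 1)]` and `[Y j, Y (j + 1)]`, written as a mixed second
  -- difference of `min (X i) (Y j)` so that its row and column sums telescope.
  let W : ℕ → ℕ → ℝ := fun i j =>
    min (X (i + 1)) (Y (j + 1)) + min (X i) (Y j) - (min (X (i + 1)) (Y j) + min (X i) (Y (j + 1)))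
  have hW0 : ∀ i j, 0 ≤ W i j := fun i j =>
    sub_nonneg.2 (min_add_min_le (hXm i.le_succ) (hYm j.le_succ))
  have hWX : ∀ i j, W i j ≠ 0 → X i < Y (j + 1) := by
    intro i j h
    by_contra h'
    have h1 := not_lt.1 h'
    have h2 : Y j ≤ Y (j + 1) := hYm j.le_succ
    have h3 : X i ≤ X (i + 1) := hXm i.le_succ
    apply h
    simp only [W]
    rw [min_eq_right (h1.trans h3), min_eq_right h1, min_eq_right (h2.trans h1),
      min_eq_right (h2.trans (h1.trans h3))]
    ring
  have hWY : ∀ i j, W i j ≠ 0 → Y j < X (i + 1) := by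
    intro i j h
    by_contra h'
    have h1 := not_lt.1 h'
    have h2 : Y j ≤ Y (j + 1) := hYm j.le_succ
    have h3 : X i ≤ X (i + 1) := hXm i.le_succ
    apply h
    simp only [W]
    rw [min_eq_left (h1.trans h2), min_eq_left h1, min_eq_left (h3.trans h1),
      min_eq_left (h3.trans (h1.trans h2))]
    ring
  let w : Fin n × Fin n → ℝ := fun q => W (q.1 - l : Fin n) (q.2 - l : Fin n)
  -- Overlapping pieces appear in the same order in both subdivisions, so the support is a chain; `Y
  -- ≤ X` puts it weakly above the diagonal.
  obtain ⟨s, hs, hws⟩ := exists_dyckSimplex_of_chain l (Finset.univ.filter fun q => w q ≠ 0)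
    (by
      intro q hq
      have hq := (Finset.mem_filter.1 hq).2
      by_contra h
      have h := Fin.lt_def.1 (not_le.1 h)
      have h1 := hWX _ _ hq
      have h2 : X (((q.2 - l : Fin n) : ℕ) + 1) ≤ X ((q.1 - l : Fin n) : ℕ) := hXm h
      linarith [hXY (((q.2 - l : Fin n) : ℕ) + 1)])
    (by
      intro q hq q' hq' hlt
      have hq := (Finset.mem_filter.1 hq).2
      have hq' := (Finset.mem_filter.1 hq').2
      by_contra h
      have h := Fin.lt_def.1 (not_le.1 h)
      have hlt := Fin.lt_def.1 hlt
      have h1 := hWX _ _ hq'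
      have h2 := hWY _ _ hq
      have h3 : X (((q.1 - l : Fin n) : ℕ) + 1) ≤ X ((q'.1 - l : Fin n) : ℕ) := hXm hlt
      have h4 : Y (((q'.2 - l : Fin n) : ℕ) + 1) ≤ Y ((q.2 - l : Fin n) : ℕ) := hYm h
      linarith)
  refine ⟨s, hs, w, fun q => hW0 _ _, fun q hq => ?_, fun i => ?_, fun j => ?_⟩
  · by_contra h
    exact hq (hws (Finset.mem_filter.2 ⟨Finset.mem_univ _, h⟩))
  · have hi := (i - l : Fin n).isLt
    have key : ∑ j ∈ Finset.range n, W (i - l : Fin n) j = x i := by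
      have : ∀ j, W (i - l : Fin n) j =
          (min (X (((i - l : Fin n) : ℕ) + 1)) (Y (j + 1)) - min (X (i - l : Fin n)) (Y (j + 1))) -
          (min (X (((i - l : Fin n) : ℕ) + 1)) (Y j) - min (X (i - l : Fin n)) (Y j)) :=
        fun j => by simp only [W]; ring
      rw [Finset.sum_congr rfl fun j _ => this j, Finset.sum_range_sub (fun j =>
        min (X (((i - l : Fin n) : ℕ) + 1)) (Y j) - min (X (i - l : Fin n)) (Y j)), ← hXn, hY0,
        min_eq_left (hXm hi), min_eq_left (hXm hi.le), min_eq_right (hX0 ▸ hXm (Nat.zero_le _)),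
        min_eq_right (hX0 ▸ hXm (Nat.zero_le _))]
      simp only [X, Finset.sum_range_succ, hcast]
      ring
    rw [← key, ← Fin.sum_univ_eq_sum_range,
      ← Equiv.sum_comp (Equiv.subRight l) fun j : Fin n => W (i - l : Fin n) j]
    rfl
  · have hj := (j - l : Fin n).isLt
    have key : ∑ i ∈ Finset.range n, W i (j - l : Fin n) = y j := by
      have : ∀ i, W i (j - l : Fin n) =
          (min (X (i + 1)) (Y (((j - l : Fin n) : ℕ) + 1)) - min (X (i + 1)) (Y (j - l : Fin n))) -
          (min (X i) (Y (((j - l : Fin n) : ℕ) + 1)) - min (X i) (Y (j - l : Fin n))) :=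
        fun j => by simp only [W]; ring
      rw [Finset.sum_congr rfl fun i _ => this i, Finset.sum_range_sub (fun i =>
        min (X i) (Y (((j - l : Fin n) : ℕ) + 1)) - min (X i) (Y (j - l : Fin n))), hXn, hX0,
        min_eq_right (hYm hj), min_eq_right (hYm hj.le), min_eq_left (hY0 ▸ hYm (Nat.zero_le _)),
        min_eq_left (hY0 ▸ hYm (Nat.zero_le _))]
      simp only [Y, Finset.sum_range_succ, hcast]
      ring
    rw [← key, ← Fin.sum_univ_eq_sum_range (fun i => W i (j - l : Fin n)),
      ← Equiv.sum_comp (Equiv.subRight l) fun i : Fin n => W i (j - l : Fin n)]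
    rfl

end Coupling

/-! ### Uniqueness of representations -/

section Unique

variable {n : ℕ} [NeZero n] {s : Finset (Fin n × Fin n)} {w w' : Fin n × Fin n → ℝ}

/-- On the top residue, a representation on a Dyck path simplex is dominated by all others. -/
lemma le_of_residue_eq (hs : s ∈ dyckSimplices n) (hw : ∀ q ∉ s, w q = 0) (hw' : ∀ q, 0 ≤ w' q)
    (h : ∑ q, w q • vertex n n q = ∑ q, w' q • vertex n n q) {R : ℕ}
    (hR : ∀ q, w q ≠ 0 → residue q ≤ R) (hR' : ∀ q, w' q ≠ 0 → residue q ≤ R)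
    {q : Fin n × Fin n} (hq : residue q = R) : w q ≤ w' q := by
  by_cases hwq : w q = 0
  · rw [hwq]; exact hw' q
  have hqs : q ∈ s := by by_contra h'; exact hwq (hw q h')
  -- The functional reads off exactly `w q` from the left side and at most `w' q` from the right.
  obtain ⟨f, h1, h2, h3, -⟩ := exists_separating hs hqs
  have hf := congrArg f h
  rw [map_sum_smul_vertex, map_sum_smul_vertex] at hf
  have e1 : ∑ p, w p * f (vertex n n p) = w q := by
    rw [Finset.sum_eq_single q, h1, mul_one]
    · intro p _ hpq
      by_cases hp : w p = 0
      · rw [hp, zero_mul]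
      · rw [h3 p (by by_contra h'; exact hp (hw p h')) hpq (hq ▸ hR p hp), mul_zero]
    · simp
  have e2 : ∑ p, w' p * f (vertex n n p) ≤ w' q := by
    rw [← Finset.add_sum_erase _ _ (Finset.mem_univ q), h1, mul_one]
    refine add_le_of_nonpos_right (Finset.sum_nonpos fun p hp => ?_)
    have hpq := Finset.ne_of_mem_erase hp
    by_cases hp : w' p = 0
    · rw [hp, zero_mul]
    · exact mul_nonpos_of_nonneg_of_nonpos (hw' p) (h2 p hpq (hq ▸ hR' p hp))
  linarith

/-- A representation on a Dyck path simplex has the least possible top residue. -/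
lemma residue_le_of_residue_le (hs : s ∈ dyckSimplices n) (hw : ∀ q ∉ s, w q = 0)
    (hw0 : ∀ q, 0 ≤ w q) (hw' : ∀ q, 0 ≤ w' q)
    (h : ∑ q, w q • vertex n n q = ∑ q, w' q • vertex n n q) {R : ℕ}
    (hR' : ∀ q, w' q ≠ 0 → residue q ≤ R) : ∀ q, w q ≠ 0 → residue q ≤ R := by
  by_contra! hcon
  obtain ⟨q, hq, hqR⟩ := hcon
  -- At a square of largest residue above `R`, domination by `w' p = 0` contradicts `w p ≠ 0`.
  obtain ⟨p, hp, hmax⟩ := Finset.exists_max_image (Finset.univ.filter fun q => w q ≠ 0) residue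
    ⟨q, by simpa using hq⟩
  have hRp : R < residue p := hqR.trans_le (hmax q (by simpa using hq))
  have hle := le_of_residue_eq hs hw hw' h (R := residue p) (fun q hq => hmax q (by simpa using hq))
    (fun q hq => (hR' q hq).trans hRp.le) rfl
  have : w' p = 0 := by
    by_contra h'
    exact absurd (hR' p h') (not_le.2 hRp)
  exact (Finset.mem_filter.1 hp).2 (le_antisymm (this ▸ hle) (hw0 p))

lemma eq_of_sum_smul_vertex_eq {t : Finset (Fin n × Fin n)} (hs : s ∈ dyckSimplices n)
    (ht : t ∈ dyckSimplices n) (hw : ∀ q ∉ s, w q = 0) (hw' : ∀ q ∉ t, w' q = 0)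
    (hw0 : ∀ q, 0 ≤ w q) (hw0' : ∀ q, 0 ≤ w' q)
    (h : ∑ q, w q • vertex n n q = ∑ q, w' q • vertex n n q) : w = w' := by
  -- Induction on a strict bound for the residues in both supports: the top layers agree by
  -- domination both ways and are subtracted.
  suffices H : ∀ (R : ℕ) (w w' : Fin n × Fin n → ℝ), (∀ q ∉ s, w q = 0) → (∀ q ∉ t, w' q = 0) →
      (∀ q, 0 ≤ w q) → (∀ q, 0 ≤ w' q) →
      ∑ q, w q • vertex n n q = ∑ q, w' q • vertex n n q →
      (∀ q, w q ≠ 0 → residue q < R) → (∀ q, w' q ≠ 0 → residue q < R) → w = w' from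
    H n w w' hw hw' hw0 hw0' h (fun q _ => Fin.isLt _) (fun q _ => Fin.isLt _)
  intro R
  induction R with
  | zero =>
    intro w w' _ _ _ _ _ h h'
    funext q
    rw [show w q = 0 by by_contra hc; exact absurd (h q hc) (Nat.not_lt_zero _),
      show w' q = 0 by by_contra hc; exact absurd (h' q hc) (Nat.not_lt_zero _)]
  | succ R ih =>
    intro w w' hw hw' hw0 hw0' h hR hR'
    have htop : ∀ q, residue q = R → w q = w' q := fun q hq => le_antisymm
      (le_of_residue_eq hs hw hw0' h (fun q hq => Nat.lt_succ_iff.1 (hR q hq))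
        (fun q hq => Nat.lt_succ_iff.1 (hR' q hq)) hq)
      (le_of_residue_eq ht hw' hw0 h.symm (fun q hq => Nat.lt_succ_iff.1 (hR' q hq))
        (fun q hq => Nat.lt_succ_iff.1 (hR q hq)) hq)
    have hlow := ih (fun q => if residue q = R then 0 else w q)
      (fun q => if residue q = R then 0 else w' q)
      (fun q hq => by simp [hw q hq]) (fun q hq => by simp [hw' q hq])
      (fun q => by split_ifs; exacts [le_rfl, hw0 q])
      (fun q => by split_ifs; exacts [le_rfl, hw0' q])
      (by
        have split : ∀ v : Fin n × Fin n → ℝ,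
            ∑ q, (if residue q = R then 0 else v q) • vertex n n q =
              ∑ q, v q • vertex n n q -
                ∑ q, (if residue q = R then v q else 0) • vertex n n q := by
          intro v
          rw [← Finset.sum_sub_distrib]
          refine Finset.sum_congr rfl fun q _ => ?_
          split_ifs <;> simp
        rw [split, split, h]
        congr 1
        refine Finset.sum_congr rfl fun q _ => ?_
        split_ifs with hq
        · rw [htop q hq]
        · rfl)
      (fun q hq => by
        split_ifs at hq with h1
        · exact absurd rfl hq
        · have := hR q hq; omega)
      (fun q hq => by
        split_ifs at hq with h1
        · exact absurd rfl hq
        · have := hR' q hq; omega)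
    funext q
    by_cases hq : residue q = R
    · exact htop q hq
    · simpa [hq] using congrFun hlow q

end Unique

/-! ### The triangulation -/

section Hull

variable {n : ℕ}

lemma vertex_injective : Function.Injective (vertex n n) := by
  intro p q h
  have h1 := congrFun (congrArg Prod.fst h) q.1
  have h2 := congrFun (congrArg Prod.snd h) q.2
  simp only [vertex, Pi.single_apply, if_true] at h1 h2
  refine Prod.ext ?_ ?_
  · by_contra hc; simp [Ne.symm hc] at h1
  · by_contra hc; simp [Ne.symm hc] at h2

lemma sum_eq_sum_of_sum_smul_vertex_eq {w w' : Fin n × Fin n → ℝ}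
    (h : ∑ q, w q • vertex n n q = ∑ q, w' q • vertex n n q) : ∑ q, w q = ∑ q, w' q := by
  have := congrArg (cut Finset.univ ∅) h
  rw [map_sum_smul_vertex, map_sum_smul_vertex] at this
  simpa [cut_vertex] using this

lemma mem_convexHull_vertex {B : Set (Fin n × Fin n)} {y : (Fin n → ℝ) × (Fin n → ℝ)} :
    y ∈ convexHull ℝ (vertex n n '' B) ↔ ∃ w : Fin n × Fin n → ℝ, (∀ q, 0 ≤ w q) ∧
      (∀ q ∉ B, w q = 0) ∧ ∑ q, w q = 1 ∧ ∑ q, w q • vertex n n q = y := by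
  classical
  constructor
  · intro hy
    refine convexHull_min (t := {y | ∃ w : Fin n × Fin n → ℝ, (∀ q, 0 ≤ w q) ∧
      (∀ q ∉ B, w q = 0) ∧ ∑ q, w q = 1 ∧ ∑ q, w q • vertex n n q = y}) ?_ ?_ hy
    · rintro _ ⟨p, hp, rfl⟩
      refine ⟨Pi.single p 1, fun q => ?_, fun q hq => Pi.single_eq_of_ne (fun h => hq (by rwa [h])) 1,
        by simp, by simp [Pi.single_apply]⟩
      rw [Pi.single_apply]
      split_ifs <;> simp
    · rintro _ ⟨w, hw0, hwB, hw1, rfl⟩ _ ⟨v, hv0, hvB, hv1, rfl⟩ a b ha hb hab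
      refine ⟨fun q => a * w q + b * v q,
        fun q => add_nonneg (mul_nonneg ha (hw0 q)) (mul_nonneg hb (hv0 q)),
        fun q hq => by simp [hwB q hq, hvB q hq], ?_, ?_⟩
      · rw [Finset.sum_add_distrib, ← Finset.mul_sum, ← Finset.mul_sum, hw1, hv1, mul_one,
          mul_one, hab]
      · simp only [add_smul, mul_smul, Finset.sum_add_distrib, Finset.smul_sum]
  · rintro ⟨w, hw0, hwB, hw1, rfl⟩
    have key : ∀ {M : Type} [AddCommMonoid M] (g : Fin n × Fin n → M), (∀ q ∉ B, g q = 0) →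
        ∑ q ∈ Finset.univ.filter (· ∈ B), g q = ∑ q, g q := by
      intro M _ g hg
      refine Finset.sum_subset (Finset.filter_subset _ _) fun q _ hq => hg q fun hB => hq ?_
      exact Finset.mem_filter.2 ⟨Finset.mem_univ _, hB⟩
    rw [← key _ fun q hq => by rw [hwB q hq, zero_smul]]
    refine (convex_convexHull ℝ _).sum_mem (fun q _ => hw0 q) ((key w hwB).trans hw1)
      fun q hq => subset_convexHull ℝ _ (Set.mem_image_of_mem _ (Finset.mem_filter.1 hq).2)

lemma mem_simplexProduct_of_weights {w : Fin n × Fin n → ℝ} (hw : ∀ q, 0 ≤ w q)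
    (h1 : ∑ q, w q = 1) : ∑ q, w q • vertex n n q ∈ simplexProduct n n := by
  rw [sum_smul_vertex]
  rw [Fintype.sum_prod_type] at h1
  refine ⟨⟨fun i => show 0 ≤ ∑ j, w (i, j) from Finset.sum_nonneg fun j _ => hw (i, j), h1⟩,
    fun j => show 0 ≤ ∑ i, w (i, j) from Finset.sum_nonneg fun i _ => hw (i, j), ?_⟩
  rw [← h1, Finset.sum_comm]

variable [NeZero n]

lemma exists_weights_of_mem_simplexProduct {y : (Fin n → ℝ) × (Fin n → ℝ)}
    (hy : y ∈ simplexProduct n n) : ∃ s ∈ dyckSimplices n, ∃ w : Fin n × Fin n → ℝ,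
      (∀ q, 0 ≤ w q) ∧ (∀ q ∉ s, w q = 0) ∧ ∑ q, w q = 1 ∧ ∑ q, w q • vertex n n q = y := by
  obtain ⟨⟨hx0, hx1⟩, hy0, hy1⟩ := hy
  obtain ⟨s, hs, w, hw0, hws, hwx, hwy⟩ := exists_coupling y.1 y.2 hx0 hy0 (hx1.trans hy1.symm)
  refine ⟨s, hs, w, hw0, hws, ?_, ?_⟩
  · rw [Fintype.sum_prod_type, ← hx1]
    exact Finset.sum_congr rfl fun i _ => hwx i
  · rw [sum_smul_vertex]
    exact Prod.ext (funext hwx) (funext hwy)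

/-- The positive and negative parts of a vanishing combination have the same marginals, so they
coincide by uniqueness; having disjoint supports, they vanish. -/
lemma linearIndepOn_vertex {s : Finset (Fin n × Fin n)} (hs : s ∈ dyckSimplices n) :
    LinearIndepOn ℝ (vertex n n) (s : Set (Fin n × Fin n)) := by
  classical
  rw [linearIndepOn_finset_iff]
  intro g hg q hq
  have hsum : ∑ p, (if p ∈ s then g p else 0) • vertex n n p = 0 := by
    rw [← hg]
    simp [ite_smul, Finset.sum_ite_mem]
  have := eq_of_sum_smul_vertex_eq hs hs (w := fun p => max (if p ∈ s then g p else 0) 0)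
    (w' := fun p => max (-(if p ∈ s then g p else 0)) 0) (fun p hp => by simp [hp])
    (fun p hp => by simp [hp]) (fun p => le_max_right _ _) (fun p => le_max_right _ _)
    (by
      rw [← sub_eq_zero, ← Finset.sum_sub_distrib, ← hsum]
      refine Finset.sum_congr rfl fun p _ => ?_
      rw [← sub_smul]
      congr 1
      rcases le_total (if p ∈ s then g p else 0) 0 with h | h
      · rw [max_eq_right h, max_eq_left (neg_nonneg.2 h)]; ring
      · rw [max_eq_left h, max_eq_right (neg_nonpos.2 h)]; ring)
  have h := congrFun this q
  simp only [hq, if_true] at h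
  rcases le_total (g q) 0 with h' | h'
  · rw [max_eq_right h', max_eq_left (neg_nonneg.2 h')] at h; linarith
  · rw [max_eq_left h', max_eq_right (neg_nonpos.2 h')] at h; exact h

open Classical in
lemma isTriangulation_dyckSimplices : IsTriangulation (dyckSimplices n) := by
  let faces : Set (Finset ((Fin n → ℝ) × (Fin n → ℝ))) :=
    {F | ∃ t : Finset (Fin n × Fin n), t.Nonempty ∧ (∃ s ∈ dyckSimplices n, t ⊆ s) ∧
      F = t.image (vertex n n)}
  have hne : ∀ s ∈ dyckSimplices n, s.Nonempty := fun s hs => Finset.card_pos.1 (by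
    rw [card_of_mem_dyckSimplices hs]
    have := NeZero.ne n
    omega)
  have hmem : ∀ s ∈ dyckSimplices n, s.image (vertex n n) ∈ faces := fun s hs =>
    ⟨s, hne s hs, ⟨s, hs, subset_rfl⟩, rfl⟩
  let K : Geometry.SimplicialComplex ℝ ((Fin n → ℝ) × (Fin n → ℝ)) :=
    { faces := faces
      isRelLowerSet_faces := by
        rintro _ ⟨t, ht, ⟨s, hs, hts⟩, rfl⟩
        refine ⟨ht.image _, fun F hF hFne => ?_⟩
        obtain ⟨t', ht', rfl⟩ := Finset.subset_image_iff.1 hF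
        exact ⟨t', Finset.image_nonempty.1 hFne, ⟨s, hs, ht'.trans hts⟩, rfl⟩
      indep := by
        rintro _ ⟨t, ht, ⟨s, hs, hts⟩, rfl⟩
        have h := (linearIndepOn_vertex hs).linearIndependent.affineIndependent.range
        refine h.mono ?_
        intro y hy
        obtain ⟨q, hq, rfl⟩ := Finset.mem_image.1 hy
        exact ⟨⟨q, hts hq⟩, rfl⟩
      inter_subset_convexHull := by
        rintro _ _ ⟨t, ht, ⟨s, hs, hts⟩, rfl⟩ ⟨t', ht', ⟨s', hs', hts'⟩, rfl⟩ y ⟨hy, hy'⟩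
        rw [Finset.coe_image, mem_convexHull_vertex] at hy hy'
        obtain ⟨w, hw0, hwt, hw1, rfl⟩ := hy
        obtain ⟨w', hw0', hwt', hw1', h⟩ := hy'
        -- A common point has the same weights in both faces, so these are supported on the common
        -- vertices.
        obtain rfl := eq_of_sum_smul_vertex_eq hs hs' (fun q hq => hwt q fun h => hq (hts h))
          (fun q hq => hwt' q fun h => hq (hts' h)) hw0 hw0' h.symm
        rw [Finset.coe_image, Finset.coe_image, ← Set.image_inter vertex_injective]
        refine mem_convexHull_vertex.2 ⟨w, hw0, fun q hq => ?_, hw1, rfl⟩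
        by_cases hqt : q ∈ t
        · exact hwt' q fun h => hq ⟨hqt, h⟩
        · exact hwt q hqt }
  refine ⟨K, ?_, ?_, ?_⟩
  · rintro y ⟨t, ht, -, hy⟩
    have : y ∈ t.image (vertex n n) := hy ▸ Finset.mem_singleton_self y
    obtain ⟨q, -, rfl⟩ := Finset.mem_image.1 this
    exact ⟨q, rfl⟩
  · ext y
    rw [Geometry.SimplicialComplex.mem_space_iff]
    constructor
    · rintro ⟨_, ⟨t, ht, -, rfl⟩, hy⟩
      rw [Finset.coe_image, mem_convexHull_vertex] at hy
      obtain ⟨w, hw0, -, hw1, rfl⟩ := hy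
      exact mem_simplexProduct_of_weights hw0 hw1
    · intro hy
      obtain ⟨s, hs, w, hw0, hws, hw1, hwy⟩ := exists_weights_of_mem_simplexProduct hy
      refine ⟨_, hmem s hs, ?_⟩
      rw [Finset.coe_image, mem_convexHull_vertex]
      exact ⟨w, hw0, hws, hw1, hwy⟩
  · ext F
    rw [Geometry.SimplicialComplex.mem_facets]
    constructor
    · rintro ⟨⟨t, ht, ⟨s, hs, hts⟩, rfl⟩, hmax⟩
      exact ⟨s, hs, (hmax _ (hmem s hs) (Finset.image_subset_image hts)).symm⟩
    · rintro ⟨s, hs, rfl⟩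
      refine ⟨hmem s hs, ?_⟩
      rintro _ ⟨t, ht, ⟨s', hs', hts⟩, rfl⟩ hst
      rw [Finset.image_subset_image_iff vertex_injective] at hst
      obtain rfl := eq_of_subset_of_mem_dyckSimplices hs hs' (hst.trans hts)
      rw [hst.antisymm hts]

end Hull

/-! ### The matching ensemble -/

section Ensemble

/-- Hall's theorem for the support of a coupling of almost constant marginals. -/
lemma exists_matching_of_coupling {α β : Type*} [Fintype α] [Fintype β] [DecidableEq α]
    [DecidableEq β] (w : α × β → ℝ) (hw : ∀ q, 0 ≤ w q) (I : Finset α) (J : Finset β)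
    (hIJ : I.card = J.card) (b : ℝ) (hb : b ≤ I.card + 1)
    (hrow : ∀ i ∈ I, ∑ j, w (i, j) = I.card) (hcol : ∀ j, ∑ i, w (i, j) = if j ∈ J then b else 0) :
    ∃ M : Finset (α × β), Set.InjOn Prod.fst (M : Set (α × β)) ∧
      Set.InjOn Prod.snd (M : Set (α × β)) ∧ M.image Prod.fst = I ∧ M.image Prod.snd = J ∧
      ∀ q ∈ M, w q ≠ 0 := by
  classical
  have hJ : ∀ i j, w (i, j) ≠ 0 → j ∈ J := by
    intro i j h
    by_contra hj
    have := hcol j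
    rw [if_neg hj, Finset.sum_eq_zero_iff_of_nonneg fun _ _ => hw _] at this
    exact h (this i (Finset.mem_univ i))
  let N : I → Finset β := fun i => Finset.univ.filter fun j => w (i, j) ≠ 0
  -- For a Hall violator `A` with neighbourhood `B`, the mass in the rows `A` gives `|A| |I| ≤ |B|
  -- (|I| + 1)`. With `|B| + 1 ≤ |A|` this forces `|I| ≤ |B| < |A| ≤ |I|`. The slack `b ≤ |I| + 1`
  -- is what linkage needs.
  obtain ⟨g, hg, hgN⟩ := (Finset.all_card_le_biUnion_card_iff_exists_injective N).1 (by
    intro A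
    by_contra hlt
    rw [not_le] at hlt
    set B := A.biUnion N with hB
    have hAI : A.card ≤ I.card := by
      simpa using Finset.card_le_card (Finset.subset_univ A)
    have h1 : ∑ i ∈ A, ∑ j ∈ B, w (i, j) = A.card * I.card := by
      rw [← nsmul_eq_mul, ← Finset.sum_const]
      refine Finset.sum_congr rfl fun i hi => ?_
      rw [← hrow i i.2]
      refine Finset.sum_subset (Finset.subset_univ _) fun j _ hj => ?_
      by_contra h
      exact hj (Finset.mem_biUnion.2 ⟨i, hi, Finset.mem_filter.2 ⟨Finset.mem_univ _, h⟩⟩)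
    have h2 : ∑ i ∈ A, ∑ j ∈ B, w (i, j) ≤ B.card * (I.card + 1) := by
      rw [Finset.sum_comm, ← nsmul_eq_mul, ← Finset.sum_const]
      refine Finset.sum_le_sum fun j hj => ?_
      obtain ⟨i, -, hi⟩ := Finset.mem_biUnion.1 hj
      calc ∑ i ∈ A, w (i, j) = ∑ i ∈ A.map (Function.Embedding.subtype _), w (i, j) := by simp
        _ ≤ ∑ i, w (i, j) := Finset.sum_le_sum_of_subset_of_nonneg (Finset.subset_univ _)
            fun _ _ _ => hw _
        _ = b := by rw [hcol, if_pos (hJ _ _ (Finset.mem_filter.1 hi).2)]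
        _ ≤ _ := hb
    have h3 : A.card * I.card ≤ B.card * (I.card + 1) := by
      rw [h1] at h2
      exact_mod_cast h2
    have h4 : (B.card + 1) * I.card ≤ A.card * I.card := Nat.mul_le_mul_right _ hlt
    have h5 : I.card ≤ B.card := by
      have : B.card * I.card + I.card ≤ B.card * I.card + B.card := by
        calc _ = (B.card + 1) * I.card := by ring
          _ ≤ _ := h4.trans h3
          _ = _ := by ring
      omega
    omega)
  have hgw : ∀ i : I, w (i, g i) ≠ 0 := fun i => (Finset.mem_filter.1 (hgN i)).2
  refine ⟨Finset.univ.image fun i : I => ((i : α), g i), ?_, ?_, ?_, ?_, ?_⟩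
  · rw [Finset.coe_image]
    rintro _ ⟨i, -, rfl⟩ _ ⟨i', -, rfl⟩ h
    rw [Subtype.ext h]
  · rw [Finset.coe_image]
    rintro _ ⟨i, -, rfl⟩ _ ⟨i', -, rfl⟩ h
    rw [hg h]
  · rw [Finset.image_image]
    ext i
    simp
  · rw [Finset.image_image]
    refine Finset.eq_of_subset_of_card_le ?_ ?_
    · intro j hj
      obtain ⟨i, -, rfl⟩ := Finset.mem_image.1 hj
      exact hJ _ _ (hgw i)
    · rw [Finset.card_image_of_injective _ (f := Prod.snd ∘ fun i : I => ((i : α), g i)) hg]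
      simp [hIJ]
  · intro q hq
    obtain ⟨i, -, rfl⟩ := Finset.mem_image.1 hq
    exact hgw i

lemma injOn_insert_erase {α β : Type*} [DecidableEq α] [DecidableEq β] {f : α → β} {M : Finset α}
    (h : Set.InjOn f (M : Set α)) {e e' : α} (he : e ∈ M) (h' : f e' = f e ∨ f e' ∉ M.image f) :
    Set.InjOn f (insert e' (M.erase e) : Finset α) := by
  have key : ∀ b ∈ M, b ≠ e → f e' ≠ f b := by
    intro b hb hbe hf
    rcases h' with h' | h'
    · exact hbe (h hb he (hf.symm.trans h'))
    · exact h' (hf ▸ Finset.mem_image_of_mem f hb)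
  intro a ha b hb hab
  rw [Finset.mem_coe, Finset.mem_insert, Finset.mem_erase] at ha hb
  rcases ha with rfl | ⟨ha, ha'⟩ <;> rcases hb with rfl | ⟨hb, hb'⟩
  · rfl
  · exact absurd hab (key b hb' hb)
  · exact absurd hab.symm (key a ha' ha)
  · exact h ha' hb' hab

variable {n : ℕ}

lemma sum_vertex_of_isMatching {M : Finset (Fin n × Fin n)} (hM : IsMatching M) :
    ∑ q, (if q ∈ M then (1 : ℝ) else 0) • vertex n n q =
      (∑ i ∈ M.image Prod.fst, Pi.single i 1, ∑ j ∈ M.image Prod.snd, Pi.single j 1) := by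
  rw [Finset.sum_image hM.1, Finset.sum_image hM.2]
  simp only [ite_smul, one_smul, zero_smul, Finset.sum_ite_mem, Finset.univ_inter]
  exact Prod.ext (by simp [Prod.fst_sum, vertex]) (by simp [Prod.snd_sum, vertex])

lemma nonempty_of_image_fst_eq {M : Finset (Fin n × Fin n)} {I : Finset (Fin n)}
    (hI : I.Nonempty) (h : M.image Prod.fst = I) : M.Nonempty :=
  Finset.image_nonempty.1 (h ▸ hI)

variable [NeZero n]

/-- The indicators of matchings with equal supports have equal marginals, so uniqueness of weights
applies. -/
lemma eq_of_mem_matchingsOf {M M' : Finset (Fin n × Fin n)}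
    (hM : M ∈ matchingsOf (dyckSimplices n)) (hM' : M' ∈ matchingsOf (dyckSimplices n))
    (h1 : M.image Prod.fst = M'.image Prod.fst) (h2 : M.image Prod.snd = M'.image Prod.snd) :
    M = M' := by
  obtain ⟨-, hM, s, hs, hMs⟩ := hM
  obtain ⟨-, hM', s', hs', hMs'⟩ := hM'
  have := eq_of_sum_smul_vertex_eq hs hs' (w := fun q => if q ∈ M then 1 else 0)
    (w' := fun q => if q ∈ M' then 1 else 0) (fun q hq => if_neg fun h => hq (hMs h))
    (fun q hq => if_neg fun h => hq (hMs' h)) (fun q => by split_ifs <;> simp)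
    (fun q => by split_ifs <;> simp)
    (by rw [sum_vertex_of_isMatching hM, sum_vertex_of_isMatching hM', h1, h2])
  ext q
  have h := congrFun this q
  by_cases h1 : q ∈ M <;> by_cases h2 : q ∈ M' <;> simp_all

lemma isMatchingEnsemble_dyckMatchings : IsMatchingEnsemble (dyckMatchings n) := by
  rw [← matchingsOf_dyckSimplices]
  refine ⟨fun M hM => ⟨hM.1, hM.2.1⟩, ?_, ?_, ?_, ?_⟩
  · intro I J hI hIJ
    obtain ⟨s, hs, w, hw0, hws, hwx, hwy⟩ := exists_coupling
      (fun i => if i ∈ I then (I.card : ℝ) else 0) (fun j => if j ∈ J then (I.card : ℝ) else 0)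
      (fun i => by split_ifs <;> simp) (fun i => by split_ifs <;> simp) (by simp [hIJ])
    obtain ⟨M, h1, h2, h3, h4, h5⟩ := exists_matching_of_coupling w hw0 I J hIJ I.card
      (by linarith) (fun i hi => by rw [hwx, if_pos hi]) hwy
    refine ⟨M, ⟨⟨nonempty_of_image_fst_eq hI h3, ⟨h1, h2⟩, s, hs, fun q hq => ?_⟩, h3, h4⟩, ?_⟩
    · by_contra h
      exact h5 q hq (hws q h)
    · rintro M' ⟨hM', h3', h4'⟩
      refine eq_of_mem_matchingsOf hM' ⟨nonempty_of_image_fst_eq hI h3, ⟨h1, h2⟩, s, hs,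
        fun q hq => ?_⟩ (h3'.trans h3.symm) (h4'.trans h4.symm)
      by_contra h
      exact h5 q hq (hws q h)
  · rintro M ⟨-, hM, s, hs, hMs⟩ M' hM' hne
    exact ⟨hne, ⟨hM.1.mono (Finset.coe_subset.2 hM'), hM.2.mono (Finset.coe_subset.2 hM')⟩, s, hs,
      hM'.trans hMs⟩
  · intro M hM v hv
    obtain ⟨hne, hMm, -⟩ := id hM
    set I := M.image Prod.fst with hI
    set J := M.image Prod.snd with hJ
    have hIM : I.card = M.card := Finset.card_image_of_injOn hMm.1
    have hJM : J.card = M.card := Finset.card_image_of_injOn hMm.2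
    have hpos : 0 < (I.card : ℝ) := by rw [hIM]; exact_mod_cast hne.card_pos
    -- Both totals are `|I| (|I| + 1)`. The matching on `(I, J)` found in the support must be `M`,
    -- while row `v` has positive mass in some column of `J`; that entry replaces the edge of `M` in
    -- its column.
    obtain ⟨s, hs, w, hw0, hws, hwx, hwy⟩ := exists_coupling
      (fun i => if i ∈ insert v I then (I.card : ℝ) else 0)
      (fun j => if j ∈ J then (I.card + 1 : ℝ) else 0)
      (fun i => by split_ifs <;> simp) (fun i => by split_ifs <;> positivity) (by
        rw [Finset.sum_ite_mem, Finset.sum_ite_mem, Finset.univ_inter, Finset.univ_inter,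
          Finset.sum_const, Finset.sum_const, Finset.card_insert_of_notMem hv, hJM, hIM]
        simp
        ring)
    obtain ⟨M', h1, h2, h3, h4, h5⟩ := exists_matching_of_coupling w hw0 I J (hIM.trans hJM.symm)
      (I.card + 1) le_rfl (fun i hi => by rw [hwx, if_pos (Finset.mem_insert_of_mem hi)]) hwy
    have hsupp : ∀ q, w q ≠ 0 → q ∈ s := fun q h => by by_contra h'; exact h (hws q h')
    obtain rfl : M = M' := eq_of_mem_matchingsOf hM
      ⟨nonempty_of_image_fst_eq (hne.image _) h3, ⟨h1, h2⟩, s, hs, fun q hq => hsupp q (h5 q hq)⟩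
      h3.symm h4.symm
    obtain ⟨j, -, hj⟩ := Finset.exists_ne_zero_of_sum_ne_zero
      (show ∑ j, w (v, j) ≠ 0 by rw [hwx, if_pos (Finset.mem_insert_self v I)]; exact hpos.ne')
    have hjJ : j ∈ J := by
      by_contra h
      have := hwy j
      rw [if_neg h, Finset.sum_eq_zero_iff_of_nonneg fun _ _ => hw0 _] at this
      exact hj (this v (Finset.mem_univ v))
    obtain ⟨e, he, rfl⟩ := Finset.mem_image.1 hjJ
    refine ⟨e, he, (v, e.2), Or.inr rfl, rfl, Finset.insert_nonempty _ _,
      ⟨injOn_insert_erase hMm.1 he (Or.inr hv), injOn_insert_erase hMm.2 he (Or.inl rfl)⟩, s, hs,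
      Finset.insert_subset (hsupp _ hj) fun q hq => hsupp q (h5 q (Finset.mem_of_mem_erase hq))⟩
  · intro M hM v hv
    obtain ⟨hne, hMm, -⟩ := id hM
    set I := M.image Prod.fst with hI
    set J := M.image Prod.snd with hJ
    have hIM : I.card = M.card := Finset.card_image_of_injOn hMm.1
    have hJM : J.card = M.card := Finset.card_image_of_injOn hMm.2
    have hpos : 0 < (J.card : ℝ) := by rw [hJM]; exact_mod_cast hne.card_pos
    obtain ⟨s, hs, w, hw0, hws, hwx, hwy⟩ := exists_coupling
      (fun i => if i ∈ I then (J.card + 1 : ℝ) else 0)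
      (fun j => if j ∈ insert v J then (J.card : ℝ) else 0)
      (fun i => by split_ifs <;> positivity) (fun i => by split_ifs <;> simp) (by
        rw [Finset.sum_ite_mem, Finset.sum_ite_mem, Finset.univ_inter, Finset.univ_inter,
          Finset.sum_const, Finset.sum_const, Finset.card_insert_of_notMem hv, hJM, hIM]
        simp
        ring)
    -- Now the columns carry the constant mass, so Hall's argument is applied to the transpose.
    obtain ⟨N, h1, h2, h3, h4, h5⟩ := exists_matching_of_coupling (fun q => w q.swap)
      (fun q => hw0 _) J I (hJM.trans hIM.symm) (J.card + 1) le_rfl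
      (fun j hj => by
        simp only [Prod.swap_prod_mk]
        rw [hwy, if_pos (Finset.mem_insert_of_mem hj)]) hwx
    have hsupp : ∀ q, w q ≠ 0 → q ∈ s := fun q h => by by_contra h'; exact h (hws q h')
    have hN : ∀ q ∈ N.image Prod.swap, q ∈ s := by
      intro q hq
      obtain ⟨p, hp, rfl⟩ := Finset.mem_image.1 hq
      exact hsupp _ (h5 p hp)
    have h3' : (N.image Prod.swap).image Prod.snd = J := by rw [Finset.image_image]; exact h3
    have h4' : (N.image Prod.swap).image Prod.fst = I := by rw [Finset.image_image]; exact h4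
    have hNm : IsMatching (N.image Prod.swap) := by
      constructor
      · rw [Finset.coe_image]
        rintro _ ⟨a, ha, rfl⟩ _ ⟨b, hb, rfl⟩ h
        rw [h2 ha hb h]
      · rw [Finset.coe_image]
        rintro _ ⟨a, ha, rfl⟩ _ ⟨b, hb, rfl⟩ h
        rw [h1 ha hb h]
    obtain rfl : M = N.image Prod.swap := eq_of_mem_matchingsOf hM
      ⟨nonempty_of_image_fst_eq (hne.image _) h4', hNm, s, hs, hN⟩ h4'.symm h3'.symm
    obtain ⟨i, -, hi⟩ := Finset.exists_ne_zero_of_sum_ne_zero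
      (show ∑ i, w (i, v) ≠ 0 by rw [hwy, if_pos (Finset.mem_insert_self v J)]; exact hpos.ne')
    have hiI : i ∈ I := by
      by_contra h
      have := hwx i
      rw [if_neg h, Finset.sum_eq_zero_iff_of_nonneg fun _ _ => hw0 _] at this
      exact hi (this v (Finset.mem_univ v))
    obtain ⟨e, he, rfl⟩ := Finset.mem_image.1 hiI
    refine ⟨e, he, (e.1, v), Or.inl rfl, rfl, Finset.insert_nonempty _ _,
      ⟨injOn_insert_erase hMm.1 he (Or.inl rfl), injOn_insert_erase hMm.2 he (Or.inr hv)⟩, s, hs,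
      Finset.insert_subset (hsupp _ hi) fun q hq => hN q (Finset.mem_of_mem_erase hq)⟩

end Ensemble

/-! ### The pushing triangulation -/

section Pushing

variable {n : ℕ} [NeZero n]

/-- A point is visible together with a face if they span a face. -/
lemma isVisible_of_insert_subset {S : Set (Fin n × Fin n)} {a : Fin n × Fin n} (haS : a ∉ S)
    (hS : ∀ q ∈ S, residue q ≤ residue a) {s B : Finset (Fin n × Fin n)}
    (hs : s ∈ dyckSimplices n) (has : a ∈ s) (hBs : B ⊆ s) (hBS : (B : Set _) ⊆ S) :
    IsVisible (convexHull ℝ (vertex n n '' S)) (vertex n n a)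
      (convexHull ℝ (vertex n n '' (B : Set (Fin n × Fin n)))) := by
  have haB : a ∉ B := fun h => haS (hBS h)
  -- Compare coefficients at `a`, a square of top residue outside `S`. With `α = 1` and `w = 0` this
  -- shows that `a` lies outside the hull; with `α` a segment parameter it shows that the segment
  -- meets the hull only at `x`.
  have key : ∀ (α : ℝ) (w w' : Fin n × Fin n → ℝ), (∀ q ∉ B, w q = 0) →
      (∀ q, 0 ≤ w' q) → (∀ q ∉ S, w' q = 0) →
      α • vertex n n a + ∑ q, w q • vertex n n q = ∑ q, w' q • vertex n n q → α ≤ 0 := by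
    intro α w w' hwB hw0' hwS' h
    have h1 : ∑ q, ((Pi.single a α : Fin n × Fin n → ℝ) q + w q) • vertex n n q =
        ∑ q, w' q • vertex n n q := by
      rw [← h]
      simp [add_smul, Finset.sum_add_distrib, Pi.single_apply]
    have hsup : ∀ q, q ≠ a → q ∉ B → (Pi.single a α : Fin n × Fin n → ℝ) q + w q = 0 :=
      fun q h1 h2 => by rw [Pi.single_eq_of_ne h1, hwB q h2, add_zero]
    have h2 := le_of_residue_eq hs (w' := w') (fun q hq => hsup q (fun h => hq (h ▸ has))
        fun h => hq (hBs h)) hw0' h1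
      (R := residue a) (fun q hq => by
        by_cases h1 : q = a
        · rw [h1]
        · by_contra h3
          exact hq (hsup q h1 fun h => h3 (hS q (hBS h))))
      (fun q hq => hS q (by by_contra h; exact hq (hwS' q h))) rfl
    rw [hwS' a haS, hwB a haB] at h2
    simpa using h2
  refine ⟨fun ha => ?_, fun x hx => ?_⟩
  · obtain ⟨w', hw0', hwS', -, h⟩ := mem_convexHull_vertex.1 ha
    have := key 1 0 w' (by simp) hw0' hwS' (by simp [h])
    linarith
  · have hxS := convexHull_mono (Set.image_mono hBS) hx
    refine Set.Subset.antisymm ?_ (Set.singleton_subset_iff.2 ⟨right_mem_segment _ _ _, hxS⟩)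
    rintro y ⟨⟨α, β, hα, hβ, hαβ, rfl⟩, hy⟩
    obtain ⟨w, hw0, hwB, -, rfl⟩ := mem_convexHull_vertex.1 hx
    obtain ⟨w', hw0', hwS', -, h⟩ := mem_convexHull_vertex.1 hy
    have h0 : α ≤ 0 := key α (fun q => β * w q) w' (fun q hq => by simp [hwB q hq]) hw0' hwS'
      (by rw [h]; simp only [mul_smul, Finset.smul_sum])
    obtain rfl : α = 0 := le_antisymm h0 hα
    obtain rfl : β = 1 := by linarith
    simp

/-- A visible face spans a face together with the point from which it is visible. -/
lemma insert_subset_of_isVisible {S : Set (Fin n × Fin n)} {a : Fin n × Fin n} (haS : a ∉ S)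
    (hS : ∀ q ∈ S, residue q ≤ residue a) (hS' : ∀ q, residue q < residue a → q ∈ S)
    {t B : Finset (Fin n × Fin n)} (ht : t ∈ dyckSimplices n) (hBt : B ⊆ t)
    (hBS : (B : Set _) ⊆ S)
    (hvis : IsVisible (convexHull ℝ (vertex n n '' S)) (vertex n n a)
      (convexHull ℝ (vertex n n '' (B : Set (Fin n × Fin n))))) :
    ∃ s ∈ dyckSimplices n, insert a B ⊆ s := by
  rcases B.eq_empty_or_nonempty with rfl | hB
  · obtain ⟨s, hs, h⟩ := exists_dyckSimplex_mem a
    exact ⟨s, hs, by simpa using h⟩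
  obtain ⟨haP, hvis⟩ := hvis
  have haB : a ∉ B := fun h => haS (hBS h)
  have hcard : (0 : ℝ) < B.card := by exact_mod_cast hB.card_pos
  -- Barycentric weights are positive on all of `B`, so a simplex that carries them contains `B`.
  set u : Fin n × Fin n → ℝ := fun q => if q ∈ B then (B.card : ℝ)⁻¹ else 0 with hu
  have hu0 : ∀ q, 0 ≤ u q := fun q => by simp only [hu]; split_ifs <;> positivity
  have huB : ∀ q ∉ B, u q = 0 := fun q hq => if_neg hq
  have hu1 : ∑ q, u q = 1 := by simp [hu, Finset.sum_ite_mem, hcard.ne']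
  set x := ∑ q, u q • vertex n n q with hx
  have hxB : x ∈ convexHull ℝ (vertex n n '' (B : Set (Fin n × Fin n))) :=
    mem_convexHull_vertex.2 ⟨u, hu0, huB, hu1, rfl⟩
  have hxP := convexHull_mono (Set.image_mono hBS) hxB
  set v : Fin n × Fin n → ℝ := fun q => (Pi.single a (1 / 2) : Fin n × Fin n → ℝ) q + 1 / 2 * u q
    with hv
  have hsingle : ∀ q, 0 ≤ (Pi.single a (1 / 2) : Fin n × Fin n → ℝ) q := fun q => by
    rw [Pi.single_apply]; split_ifs <;> norm_num
  have hv0 : ∀ q, 0 ≤ v q := fun q => add_nonneg (hsingle q) (mul_nonneg (by norm_num) (hu0 q))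
  have hvS : ∀ q, q ≠ a → q ∉ B → v q = 0 := fun q h1 h2 => by
    simp only [hv]; rw [Pi.single_eq_of_ne h1, huB q h2]; norm_num
  have hva : v a = 1 / 2 := by simp only [hv]; rw [Pi.single_eq_same, huB a haB]; norm_num
  have hv1 : ∑ q, v q = 1 := by
    simp only [hv]
    rw [Finset.sum_add_distrib, ← Finset.mul_sum, hu1]
    simp
    norm_num
  have hvy : ∑ q, v q • vertex n n q = (1 / 2 : ℝ) • vertex n n a + (1 / 2 : ℝ) • x := by
    simp [hv, hx, add_smul, Finset.sum_add_distrib, Pi.single_apply, Finset.smul_sum, mul_smul]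
  -- A Dyck path simplex `s` through the midpoint of `a` and `x`; the aim is to show that `w` gives
  -- `a` weight `1 / 2` and the rest is `u / 2`.
  obtain ⟨s, hs, w, hw0, hws, hw1, hwy⟩ :=
    exists_weights_of_mem_simplexProduct (mem_simplexProduct_of_weights hv0 hv1)
  have hvR : ∀ q, v q ≠ 0 → residue q ≤ residue a := by
    intro q hq
    by_cases h1 : q = a
    · rw [h1]
    · exact hS q (hBS (by by_contra h2; exact hq (hvS q h1 h2)))
  have hwR := residue_le_of_residue_le hs hws hw0 hv0 hwy hvR
  have hwv := fun q => le_of_residue_eq hs hws hv0 hwy hwR hvR (q := q)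
  -- Squares of smaller residue lie in `S`; on squares with the residue of `a`, domination by `v`
  -- excludes those outside `S` other than `a`.
  have hwS : ∀ q, q ≠ a → q ∉ S → w q = 0 := by
    intro q h1 h2
    by_contra h3
    rcases (hwR q h3).lt_or_eq with h | h
    · exact h2 (hS' q h)
    · have h4 := hwv q h
      rw [hvS q h1 fun hB => h2 (hBS hB)] at h4
      exact h3 (le_antisymm h4 (hw0 q))
  have hwa : w a ≤ 1 / 2 := hva ▸ hwv a rfl
  -- `z` is the residual point on the segment
  set r : Fin n × Fin n → ℝ := fun q => w q - (Pi.single a (w a) : Fin n × Fin n → ℝ) q with hr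
  have hra : r a = 0 := by simp [hr]
  have hrne : ∀ q, q ≠ a → r q = w q := fun q h => by
    simp only [hr]; rw [Pi.single_eq_of_ne h, sub_zero]
  have hr0 : ∀ q, 0 ≤ r q := fun q => by
    by_cases h : q = a
    · rw [h, hra]
    · rw [hrne q h]; exact hw0 q
  have hrS : ∀ q ∉ S, r q = 0 := fun q h => by
    by_cases h' : q = a
    · rw [h', hra]
    · rw [hrne q h']; exact hwS q h' h
  have hr1 : ∑ q, r q = 1 - w a := by
    simp only [hr]
    rw [Finset.sum_sub_distrib, hw1]
    simp
  have hry : ∑ q, r q • vertex n n q = (1 / 2 - w a) • vertex n n a + (1 / 2 : ℝ) • x := by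
    have : ∑ q, r q • vertex n n q = ∑ q, w q • vertex n n q - w a • vertex n n a := by
      simp [hr, sub_smul, Finset.sum_sub_distrib, Pi.single_apply]
    rw [this, hwy, hvy, sub_smul]
    abel
  have hpos : 0 < 1 - w a := by linarith
  -- Removing the share of `a` and rescaling leaves a point of the segment that is a convex
  -- combination over `S`; visibility makes it `x`.
  have hz : (1 - w a)⁻¹ • ∑ q, r q • vertex n n q ∈
      segment ℝ (vertex n n a) x ∩ convexHull ℝ (vertex n n '' S) := by
    constructor
    · refine ⟨(1 - w a)⁻¹ * (1 / 2 - w a), (1 - w a)⁻¹ * (1 / 2),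
        mul_nonneg (by positivity) (by linarith), by positivity, ?_, ?_⟩
      · field_simp; ring
      · rw [hry, smul_add, smul_smul, smul_smul]
    · refine mem_convexHull_vertex.2 ⟨fun q => (1 - w a)⁻¹ * r q,
        fun q => mul_nonneg (by positivity) (hr0 q), fun q hq => by simp [hrS q hq], ?_, ?_⟩
      · rw [← Finset.mul_sum, hr1, inv_mul_cancel₀ hpos.ne']
      · simp only [mul_smul, Finset.smul_sum]
  rw [hvis x hxB, Set.mem_singleton_iff] at hz
  have hz' : ∑ q, r q • vertex n n q = (1 - w a) • x := by
    rw [← hz, smul_smul, mul_inv_cancel₀ hpos.ne', one_smul]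
  have hwa' : w a = 1 / 2 := by
    by_contra hne
    have h0 : (1 / 2 - w a) • (vertex n n a - x) = 0 := by
      rw [hry] at hz'
      have : (1 - w a) • x = (1 / 2 - w a) • x + (1 / 2 : ℝ) • x := by
        rw [← add_smul]; congr 1; ring
      rw [this, add_left_inj] at hz'
      rw [smul_sub, hz', sub_self]
    rcases smul_eq_zero.1 h0 with h | h
    · exact hne (by linarith)
    · exact haP (sub_eq_zero.1 h ▸ hxP)
  have has : a ∈ s := by
    by_contra h
    rw [hws a h] at hwa'
    norm_num at hwa'
  have hru : r = fun q => 1 / 2 * u q := by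
    refine eq_of_sum_smul_vertex_eq hs ht (fun q hq => ?_) (fun q hq => ?_) hr0
      (fun q => mul_nonneg (by norm_num) (hu0 q)) ?_
    · rw [hrne q fun h => hq (h ▸ has), hws q hq]
    · rw [huB q fun h => hq (hBt h), mul_zero]
    · rw [hz', hwa', hx]
      simp only [mul_smul, Finset.smul_sum]
      norm_num
  refine ⟨s, hs, Finset.insert_subset has fun q hq => ?_⟩
  by_contra h
  have h1 := congrFun hru q
  have hqa : q ≠ a := fun h => haB (h ▸ hq)
  rw [hrne q hqa, hws q h] at h1
  simp only [hu, if_pos hq] at h1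
  have : (0 : ℝ) < 1 / 2 * (B.card : ℝ)⁻¹ := by positivity
  linarith

/-- Insertion starts at the end of the list, so residues decrease along it. The condition `hlow`
passes to tails and ensures that all squares of smaller residue precede a new point, as the
visibility criterion requires. -/
lemma placeFromEnd_vertex (L : List (Fin n × Fin n)) (hnd : L.Nodup)
    (hord : L.Pairwise fun q q' => residue q' ≤ residue q)
    (hlow : ∀ p ∈ L, ∀ q, residue q < residue p → q ∈ L) :
    placeFromEnd (vertex n n) L =
      {t | (∃ s ∈ dyckSimplices n, t ⊆ s) ∧ ∀ q ∈ t, q ∈ L} := by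
  induction L with
  | nil =>
    ext t
    simp only [placeFromEnd, Set.mem_singleton_iff, Set.mem_ofPred_eq, List.not_mem_nil]
    constructor
    · rintro rfl
      obtain ⟨s, hs, -⟩ := exists_dyckSimplex_mem (0 : Fin n × Fin n)
      exact ⟨⟨s, hs, Finset.empty_subset s⟩, by simp⟩
    · rintro ⟨-, h⟩
      exact Finset.eq_empty_of_forall_notMem h
  | cons a L ih =>
    rw [List.nodup_cons] at hnd
    rw [List.pairwise_cons] at hord
    have ih := ih hnd.2 hord.2 fun p hp q hq => by
      rcases List.mem_cons.1 (hlow p (List.mem_cons_of_mem a hp) q hq) with rfl | h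
      · exact absurd (hord.1 p hp) (not_le.2 hq)
      · exact h
    have hlow' : ∀ q, residue q < residue a → q ∈ L := fun q hq =>
      (List.mem_cons.1 (hlow a List.mem_cons_self q hq)).resolve_left
        fun h => lt_irrefl _ (h ▸ hq)
    ext t
    simp only [placeFromEnd, Set.mem_union, Set.mem_ofPred_eq, ih]
    constructor
    · rintro (⟨h1, h2⟩ | ⟨B, ⟨⟨s, hs, hBs⟩, hBL⟩, hvis, ht⟩)
      · exact ⟨h1, fun q hq => List.mem_cons_of_mem a (h2 q hq)⟩
      -- `placeFromEnd` inserts with the classical decidable equality; `convert` reconciles the two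
      -- instances.
      · obtain rfl : t = insert a B := by convert ht
        refine ⟨insert_subset_of_isVisible (S := {k | k ∈ L}) hnd.1 hord.1 hlow' hs hBs hBL hvis,
          fun q hq => ?_⟩
        rcases Finset.mem_insert.1 hq with rfl | hq
        · exact List.mem_cons_self
        · exact List.mem_cons_of_mem a (hBL q hq)
    · rintro ⟨⟨s, hs, hts⟩, htL⟩
      by_cases hat : a ∈ t
      · right
        have hBL : ∀ q ∈ t.erase a, q ∈ L := fun q hq =>
          (List.mem_cons.1 (htL q (Finset.mem_of_mem_erase hq))).resolve_left
            (Finset.ne_of_mem_erase hq)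
        have hBs : t.erase a ⊆ s := (Finset.erase_subset a t).trans hts
        refine ⟨t.erase a, ⟨⟨s, hs, hBs⟩, hBL⟩,
          isVisible_of_insert_subset (S := {k | k ∈ L}) hnd.1 hord.1 hs (hts hat) hBs hBL, ?_⟩
        convert (Finset.insert_erase hat).symm
      · left
        exact ⟨⟨s, hs, hts⟩, fun q hq => (List.mem_cons.1 (htL q hq)).resolve_left
          fun h => hat (h ▸ hq)⟩

lemma pushingTriangulation_vertex {l : List (Fin n × Fin n)} (hl : IsResidueOrder l) :
    pushingTriangulation (vertex n n) l = {t | ∃ s ∈ dyckSimplices n, t ⊆ s} := by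
  obtain ⟨hnd, hall, hord⟩ := hl
  rw [pushingTriangulation, placeFromEnd_vertex l.reverse (List.nodup_reverse.2 hnd)
    (List.pairwise_reverse.2 hord) fun _ _ q _ => List.mem_reverse.2 (hall q)]
  ext t
  simp [hall]

end Pushing

/-! ### Regularity -/

section Regular

variable {n : ℕ} [NeZero n]

/-- The linear function whose graph contains the lifted vertices of `s` and lies below all other
lifted vertices. -/
lemma exists_certificate {s : Finset (Fin n × Fin n)} (hs : s ∈ dyckSimplices n) {c : ℝ}
    (hc : 1 + 2 * (Fintype.card (Fin n × Fin n) : ℝ) < c) :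
    ∃ φ : ((Fin n → ℝ) × (Fin n → ℝ)) →ₗ[ℝ] ℝ,
      (∀ p ∈ s, φ (vertex n n p) = c ^ residue p) ∧
      ∀ p ∉ s, φ (vertex n n p) < c ^ residue p := by
  set N : ℝ := (Fintype.card (Fin n × Fin n) : ℝ) with hN
  have hN0 : 0 ≤ N := Nat.cast_nonneg _
  have hc0 : 0 < c := by linarith
  -- The third clause is `|φ| ≤ (1 + 2 * N) * c ^ (k - 1)`, multiplied by `c` to allow `k = 0`. As
  -- `c > 1 + 2 * N`, all values are below `c ^ k`, so residue `k` lies strictly under its heights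
  -- before correction.
  have key : ∀ k : ℕ, ∃ φ : ((Fin n → ℝ) × (Fin n → ℝ)) →ₗ[ℝ] ℝ,
      (∀ p ∈ s, residue p < k → φ (vertex n n p) = c ^ residue p) ∧
      (∀ p ∉ s, residue p < k → φ (vertex n n p) < c ^ residue p) ∧
      ∀ p, |φ (vertex n n p)| * c ≤ (1 + 2 * N) * c ^ k := by
    intro k
    induction k with
    | zero => exact ⟨0, by simp, by simp, fun p => by simp; positivity⟩
    | succ k ih =>
      obtain ⟨φ, h1, h2, h3⟩ := ih
      have hlt : ∀ p, |φ (vertex n n p)| < c ^ k := fun p => by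
        have : (1 + 2 * N) * c ^ k < c * c ^ k := by gcongr
        nlinarith [h3 p]
      choose! f hf1 hf2 hf3 hf4 using fun q (hq : q ∈ s) => exists_separating hs hq
      set T := s.filter fun q => residue q = k with hT
      have hTs : ∀ q ∈ T, q ∈ s ∧ residue q = k := fun q hq => Finset.mem_filter.1 hq
      -- The missing height at `q`. Since it is nonnegative, adding `α q • f q` for the squares of
      -- `s` of residue `k` keeps the earlier equalities and strict inequalities. It is at most `2 *
      -- c ^ k`, which yields the term `2 * N` in the bound.
      set α : Fin n × Fin n → ℝ := fun q => c ^ k - φ (vertex n n q) with hα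
      have hα0 : ∀ q, 0 ≤ α q := fun q => sub_nonneg.2 ((le_abs_self _).trans (hlt q).le)
      have hα2 : ∀ q, α q ≤ 2 * c ^ k := fun q => by
        have := neg_abs_le (φ (vertex n n q))
        have := hlt q
        simp only [hα]; linarith
      have hval : ∀ p, (φ + ∑ q ∈ T, α q • f q) (vertex n n p) =
          φ (vertex n n p) + ∑ q ∈ T, α q * f q (vertex n n p) := fun p => by
        simp [LinearMap.sum_apply]
      have hnonpos : ∀ p, p ∉ T → residue p ≤ k → ∑ q ∈ T, α q * f q (vertex n n p) ≤ 0 :=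
        fun p hp hpk => Finset.sum_nonpos fun q hq => mul_nonpos_of_nonneg_of_nonpos (hα0 q)
          (hf2 q (hTs q hq).1 p (fun h => hp (h ▸ hq)) (hpk.trans (hTs q hq).2.ge))
      refine ⟨φ + ∑ q ∈ T, α q • f q, fun p hp hpk => ?_, fun p hp hpk => ?_, fun p => ?_⟩
      · rw [hval]
        rcases (Nat.lt_succ_iff.1 hpk).lt_or_eq with h | h
        · rw [h1 p hp h, Finset.sum_eq_zero, add_zero]
          intro q hq
          obtain ⟨hqs, hqk⟩ := hTs q hq
          rw [hf3 q hqs p hp (fun h' => by rw [h', hqk] at h; exact lt_irrefl _ h)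
            (hqk ▸ h.le), mul_zero]
        · rw [Finset.sum_eq_single_of_mem p (Finset.mem_filter.2 ⟨hp, h⟩), hf1 p hp, h]
          · simp [hα]
          · intro q hq hqp
            obtain ⟨hqs, hqk⟩ := hTs q hq
            rw [hf3 q hqs p hp hqp.symm (by rw [hqk, h]), mul_zero]
      · rw [hval]
        have hn := hnonpos p (fun h => hp (hTs p h).1) (Nat.lt_succ_iff.1 hpk)
        rcases (Nat.lt_succ_iff.1 hpk).lt_or_eq with h | h
        · linarith [h2 p hp h]
        · rw [h]
          linarith [(le_abs_self _).trans_lt (hlt p)]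
      · rw [hval, pow_succ, ← mul_assoc]
        refine mul_le_mul_of_nonneg_right ?_ hc0.le
        have hsum : |∑ q ∈ T, α q * f q (vertex n n p)| ≤ N * (2 * c ^ k) := by
          calc |∑ q ∈ T, α q * f q (vertex n n p)|
              ≤ ∑ q ∈ T, |α q * f q (vertex n n p)| := Finset.abs_sum_le_sum_abs _ _
            _ ≤ ∑ q ∈ T, 2 * c ^ k := Finset.sum_le_sum fun q hq => by
                rw [abs_mul, abs_of_nonneg (hα0 q)]
                calc α q * |f q (vertex n n p)| ≤ α q * 1 :=
                      mul_le_mul_of_nonneg_left (hf4 q (hTs q hq).1 p) (hα0 q)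
                  _ ≤ _ := by rw [mul_one]; exact hα2 q
            _ = T.card * (2 * c ^ k) := by rw [Finset.sum_const, nsmul_eq_mul]
            _ ≤ N * (2 * c ^ k) := by
                refine mul_le_mul_of_nonneg_right ?_ (by positivity)
                rw [hN]
                exact_mod_cast Finset.card_le_univ T
        linarith [abs_add_le (φ (vertex n n p)) (∑ q ∈ T, α q * f q (vertex n n p)), hlt p]
  obtain ⟨φ, h1, h2, -⟩ := key n
  exact ⟨φ, fun p hp => h1 p hp (Fin.isLt _), fun p hp => h2 p hp (Fin.isLt _)⟩

lemma regularSubdivision_vertex {c : ℝ} (hc : 1 + 2 * (Fintype.card (Fin n × Fin n) : ℝ) < c) :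
    regularSubdivision (vertex n n) (fun q => c ^ residue q) = dyckSimplices n := by
  have hcell : ∀ s ∈ dyckSimplices n, IsLowerCell (vertex n n) (fun q => c ^ residue q) s := by
    intro s hs
    obtain ⟨φ, h1, h2⟩ := exists_certificate hs hc
    refine ⟨φ.toAffineMap, fun p => ?_, fun p => ⟨h1 p, fun h => ?_⟩⟩
    · by_cases hp : p ∈ s
      · exact (h1 p hp).le
      · exact (h2 p hp).le
    · by_contra hp
      exact (h2 p hp).ne h
  have hsub : ∀ B, IsLowerCell (vertex n n) (fun q => c ^ residue q) B →
      ∃ s ∈ dyckSimplices n, B ⊆ s := by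
    rintro B ⟨ψ, hψ, hB⟩
    -- Move the indicator `u` of the cell to weights `w` on some `s` with the same marginals, and
    -- write `h` for the heights. Then `∑ u h = ∑ u ψ = ∑ w ψ ≤ ∑ w h = ∑ w φ = ∑ u φ ≤ ∑ u h`, and
    -- the last inequality is strict if `B` leaves `s`.
    set u : Fin n × Fin n → ℝ := fun q => if q ∈ B then 1 else 0 with hu
    have hu0 : ∀ q, 0 ≤ u q := fun q => by simp only [hu]; split_ifs <;> simp
    obtain ⟨s, hs, w, hw0, hws, hwx, hwy⟩ := exists_coupling (fun i => ∑ j, u (i, j))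
      (fun j => ∑ i, u (i, j)) (fun i => Finset.sum_nonneg fun j _ => hu0 _)
      (fun j => Finset.sum_nonneg fun i _ => hu0 _) Finset.sum_comm
    have hwu : ∑ q, w q • vertex n n q = ∑ q, u q • vertex n n q := by
      rw [sum_smul_vertex, sum_smul_vertex]
      exact Prod.ext (funext hwx) (funext hwy)
    have hψsum : ∀ v : Fin n × Fin n → ℝ, ∑ q, v q * ψ (vertex n n q) =
        ψ.linear (∑ q, v q • vertex n n q) + (∑ q, v q) * ψ 0 := by
      intro v
      rw [map_sum_smul_vertex, Finset.sum_mul, ← Finset.sum_add_distrib]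
      refine Finset.sum_congr rfl fun q _ => ?_
      have : ψ (vertex n n q) = ψ.linear (vertex n n q) + ψ 0 := congrFun ψ.decomp _
      rw [this, mul_add]
    have hψwu : ∑ q, w q * ψ (vertex n n q) = ∑ q, u q * ψ (vertex n n q) := by
      rw [hψsum, hψsum, hwu, sum_eq_sum_of_sum_smul_vertex_eq hwu]
    obtain ⟨φ, h1, h2⟩ := exists_certificate hs hc
    have hφwu := congrArg φ hwu
    rw [map_sum_smul_vertex, map_sum_smul_vertex] at hφwu
    have e1 : ∑ q, w q * φ (vertex n n q) = ∑ q, w q * c ^ residue q := by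
      refine Finset.sum_congr rfl fun q _ => ?_
      by_cases hq : q ∈ s
      · rw [h1 q hq]
      · rw [hws q hq, zero_mul, zero_mul]
    have e2 : ∑ q, u q * ψ (vertex n n q) = ∑ q, u q * c ^ residue q := by
      refine Finset.sum_congr rfl fun q _ => ?_
      by_cases hq : q ∈ B
      · rw [(hB q).1 hq]
      · simp [hu, hq]
    have e3 : ∑ q, w q * ψ (vertex n n q) ≤ ∑ q, w q * c ^ residue q :=
      Finset.sum_le_sum fun q _ => mul_le_mul_of_nonneg_left (hψ q) (hw0 q)
    refine ⟨s, hs, fun p hp => ?_⟩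
    by_contra hps
    have e4 : ∑ q, u q * φ (vertex n n q) < ∑ q, u q * c ^ residue q := by
      refine Finset.sum_lt_sum (fun q _ => mul_le_mul_of_nonneg_left ?_ (hu0 q))
        ⟨p, Finset.mem_univ p, ?_⟩
      · by_cases hq : q ∈ s
        · exact (h1 q hq).le
        · exact (h2 q hq).le
      · simpa [hu, hp] using h2 p hps
    linarith
  ext B
  constructor
  · rintro ⟨hB, hmax⟩
    obtain ⟨s, hs, hBs⟩ := hsub B hB
    rwa [hBs.antisymm (hmax (hcell s hs) hBs)]
  · intro hB
    refine ⟨hcell B hB, fun C hC hBC => ?_⟩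
    obtain ⟨s, hs, hCs⟩ := hsub C hC
    rw [eq_of_subset_of_mem_dyckSimplices hB hs (hBC.trans hCs)]
    exact hCs

end Regular

end DyckTriangulation

theorem theorem4p1 (n : ℕ) (hn : 1 ≤ n) :
    -- the Dyck path simplices are the maximal simplices of a triangulation
    DyckTriangulation.IsTriangulation (DyckTriangulation.dyckSimplices n) ∧
    -- its family of matchings, which is a matching ensemble
    DyckTriangulation.matchingsOf (DyckTriangulation.dyckSimplices n) =
      DyckTriangulation.dyckMatchings n ∧
    DyckTriangulation.IsMatchingEnsemble (DyckTriangulation.dyckMatchings n) ∧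
    -- it is the pushing triangulation for every order that extends the order by residues
    (∀ l : List (Fin n × Fin n), DyckTriangulation.IsResidueOrder l →
      DyckTriangulation.pushingTriangulation (DyckTriangulation.vertex n n) l =
        {t | ∃ s ∈ DyckTriangulation.dyckSimplices n, t ⊆ s}) ∧
    -- it is regular, induced by the heights `c ^ ((j - i) mod n)` for all large `c`
    ∃ c₀ : ℝ, ∀ c : ℝ, c₀ < c →
      DyckTriangulation.regularSubdivision (DyckTriangulation.vertex n n)
        (fun q => c ^ DyckTriangulation.residue q) = DyckTriangulation.dyckSimplices n := by
  have : NeZero n := ⟨by omega⟩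
  exact ⟨DyckTriangulation.isTriangulation_dyckSimplices,
    DyckTriangulation.matchingsOf_dyckSimplices,
    DyckTriangulation.isMatchingEnsemble_dyckMatchings,
    fun _ hl => DyckTriangulation.pushingTriangulation_vertex hl, _,
    fun _ hc => DyckTriangulation.regularSubdivision_vertex hc⟩
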